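/- Let $\mathbb K$ be a field of characteristic zero, let $A$ be a commutative associative $\mathbb K$-algebra that is an integral domain, with fraction field $R$, and let $W(A)=R\,\mathrm{Der}_{\mathbb K}A\subseteq \mathrm{Der}_{\mathbb K}R$ be the Lie algebra over $\mathbb K$ of all $R$-linear combinations of the (unique) extensions to $R$ of $\mathbb K$-derivations of $A$. For a $\mathbb K$-Lie subalgebra $L\subseteq W(A)$ let $RL$ be the $R$-linear span of $L$ in $\mathrm{Der}_{\mathbb K}R$, let $\mathrm{rk}_R L=\dim_R RL$, let $F=R^L=\{r\in R : D(r)=0 \text{ for all } D\in L\}$ be the field of constants of $L$, and let $FL$ be the $F$-linear span of $L$; it is a Lie algebra over $F$ under the commutator of derivations. For a field $F$ and an integer $k\ge 0$ let $u_k(F)\subseteq \mathrm{Der}_F F[x_1,\dots,x_k]$ be the triangular Lie algebra of all derivations $\sum_{i=1}^k f_i\,\frac{\partial}{\partial x_i}$ with $f_i\in F[x_{i+1},\dots,x_k]$ for all $i$ (so $f_k\in F$). If $L$ is a nilpotent subalgebra of $W(A)$ of rank $k\le 3$ over $R$, then $FL$, as a Lie algebra over $F$, is isomorphic to a finite-dimensional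 Lie subalgebra of $u_k(F)$. -/

import Mathlib

namespace FractionFieldDerivations

section WA

variable (K A R : Type*) [Field K] [CommRing A] [Algebra K A]
  [Field R] [Algebra A R] [Algebra K R]

/-- The `K`-derivations of `R` that extend a `K`-derivation of `A`. If `R = Frac A`, then every
`K`-derivation of `A` has exactly one extension to `R`, so this is the copy of `Der_K A`
inside `Der_K R`. -/
def derExt : Set (Derivation K R R) :=
  {D | ∃ d : Derivation K A A, ∀ a : A, D (algebraMap A R a) = algebraMap A R (d a)}

theorem derExt_lie {D E : Derivation K R R} (hD : D ∈ derExt K A R) (hE : E ∈ derExt K A R) :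
    ⁅D, E⁆ ∈ derExt K A R := by
  obtain ⟨d, hd⟩ := hD
  obtain ⟨e, he⟩ := hE
  refine ⟨⁅d, e⁆, fun a => ?_⟩
  simp [Derivation.commutator_apply, hd, he]

/-- `[aD, bE] = ab[D, E] + a D(b) E - b E(a) D`. -/
theorem smul_lie_smul (a b : R) (D E : Derivation K R R) :
    ⁅a • D, b • E⁆ = (a * b) • ⁅D, E⁆ + (a * D b) • E - (b * E a) • D := by
  ext x
  simp only [Derivation.commutator_apply, Derivation.smul_apply, Derivation.add_apply,
    Derivation.sub_apply, smul_eq_mul, Derivation.leibniz]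
  ring

/-- The Lie algebra `W(A) = R · Der_K A`: all `R`-linear combinations of (extensions to `R` of)
`K`-derivations of `A`, a Lie subalgebra over `K` of `Der_K R`. -/
def W : LieSubalgebra K (Derivation K R R) where
  carrier := (Submodule.span R (derExt K A R) : Set (Derivation K R R))
  add_mem' := fun hx hy => Submodule.add_mem _ hx hy
  zero_mem' := Submodule.zero_mem _
  smul_mem' := fun c x hx => by
    have h : c • x = (algebraMap K R c) • x := by
      ext y
      simp [Algebra.smul_def]
    rw [h]
    exact Submodule.smul_mem _ _ hx
  lie_mem' := fun {x y} hx hy => by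
    simp only [SetLike.mem_coe] at hx hy ⊢
    -- one generator against an arbitrary element
    have key : ∀ D ∈ derExt K A R, ∀ z ∈ Submodule.span R (derExt K A R),
        ⁅D, z⁆ ∈ Submodule.span R (derExt K A R) := by
      intro D hD z hz
      induction hz using Submodule.span_induction with
      | mem E hE => exact Submodule.subset_span (derExt_lie K A R hD hE)
      | zero => simp
      | add u v _ _ hu hv => rw [lie_add]; exact Submodule.add_mem _ hu hv
      | smul b E hE ih =>
        have h := smul_lie_smul K R 1 b D E
        simp only [one_smul, one_mul, Derivation.map_one_eq_zero, mul_zero, zero_smul,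
          sub_zero] at h
        rw [h]
        exact Submodule.add_mem _ (Submodule.smul_mem _ _ ih) (Submodule.smul_mem _ _ hE)
    induction hx using Submodule.span_induction with
    | mem D hD => exact key D hD y hy
    | zero => simp
    | add u v _ _ hu hv => rw [add_lie]; exact Submodule.add_mem _ hu hv
    | smul a D hD ih =>
      have h := smul_lie_smul K R a 1 D y
      simp only [one_smul, mul_one, Derivation.map_one_eq_zero, mul_zero, zero_smul,
        add_zero, one_mul] at h
      rw [h]
      exact Submodule.sub_mem _ (Submodule.smul_mem _ _ ih) (Submodule.smul_mem _ _ hD)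

end WA

section Constants

variable {K R : Type*} [Field K] [Field R] [Algebra K R]

/-- The field of constants `F = R^L = {r ∈ R | D(r) = 0 for all D ∈ L}`. -/
def constants (L : LieSubalgebra K (Derivation K R R)) : IntermediateField K R where
  carrier := {r | ∀ D ∈ L, D r = 0}
  mul_mem' := fun {a b} ha hb D hD => by simp [ha D hD, hb D hD]
  add_mem' := fun {a b} ha hb D hD => by simp [ha D hD, hb D hD]
  algebraMap_mem' := fun r D _ => by simp
  inv_mem' := fun a ha D hD => by simp [Derivation.leibniz_inv, ha D hD]

/-- The `R`-space `RL` of all linear combinations of elements `aD` with `a ∈ R`, `D ∈ L`. -/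
def fieldSpan (L : LieSubalgebra K (Derivation K R R)) : Submodule R (Derivation K R R) :=
  Submodule.span R (L : Set (Derivation K R R))

/-- The rank of `L` over `R`, that is `dim_R RL`, as a cardinal. -/
noncomputable def rk (L : LieSubalgebra K (Derivation K R R)) : Cardinal :=
  Module.rank R (fieldSpan L)

/-- The `F`-space `FL` of all linear combinations of elements `aD` with `a ∈ F = R^L`,
`D ∈ L`. -/
def constSpan (L : LieSubalgebra K (Derivation K R R)) :
    Submodule (constants L) (Derivation K R R) :=
  Submodule.span (constants L) (L : Set (Derivation K R R))

theorem constSpan_apply_const (L : LieSubalgebra K (Derivation K R R))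
    {D : Derivation K R R} (hD : D ∈ constSpan L) (a : constants L) : D (a : R) = 0 := by
  unfold constSpan at hD
  induction hD using Submodule.span_induction with
  | mem E hE => exact a.2 E hE
  | zero => simp
  | add u v _ _ hu hv => simp [hu, hv]
  | smul b E _ ih => simp [ih]

/-- Derivations that kill `a` commute with multiplication by `a`. -/
theorem lie_const_smul (L : LieSubalgebra K (Derivation K R R)) {D : Derivation K R R}
    (hD : D ∈ constSpan L) (a : constants L) (E : Derivation K R R) :
    ⁅D, a • E⁆ = a • ⁅D, E⁆ := by
  ext x
  have h := constSpan_apply_const L hD a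
  simp [Derivation.commutator_apply, Algebra.smul_def, h, mul_sub]

theorem constSpan_lie_mem (L : LieSubalgebra K (Derivation K R R))
    {D E : Derivation K R R} (hD : D ∈ constSpan L) (hE : E ∈ constSpan L) :
    ⁅D, E⁆ ∈ constSpan L := by
  have key : ∀ X ∈ L, ∀ Y ∈ constSpan L, ⁅X, Y⁆ ∈ constSpan L := by
    intro X hX Y hY
    have hX' : X ∈ constSpan L := Submodule.subset_span hX
    unfold constSpan at hY
    induction hY using Submodule.span_induction with
    | mem Z hZ => exact Submodule.subset_span (L.lie_mem hX hZ)
    | zero => simp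
    | add u v _ _ hu hv => rw [lie_add]; exact Submodule.add_mem _ hu hv
    | smul b Z _ ih => rw [lie_const_smul L hX']; exact Submodule.smul_mem _ _ ih
  have hD' := hD
  unfold constSpan at hD'
  induction hD' using Submodule.span_induction with
  | mem X hX => exact key X hX E hE
  | zero => simp
  | add u v hu' hv' hu hv => rw [add_lie]; exact Submodule.add_mem _ (hu hu') (hv hv')
  | smul b X hX ih =>
    rw [← lie_skew, lie_const_smul L hE, ← smul_neg, lie_skew]
    exact Submodule.smul_mem _ _ (ih hX)

/-- `FL` is a Lie ring under the commutator of derivations of `R`. -/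
instance constSpanLieRing (L : LieSubalgebra K (Derivation K R R)) :
    LieRing (constSpan L) where
  bracket x y := ⟨⁅(x : Derivation K R R), (y : Derivation K R R)⁆,
    constSpan_lie_mem L x.2 y.2⟩
  add_lie x y z := Subtype.ext (add_lie (x : Derivation K R R) (y : Derivation K R R) (z : Derivation K R R))
  lie_add x y z := Subtype.ext (lie_add (x : Derivation K R R) (y : Derivation K R R) (z : Derivation K R R))
  lie_self x := Subtype.ext (lie_self (x : Derivation K R R))
  leibniz_lie x y z := Subtype.ext (leibniz_lie (x : Derivation K R R) (y : Derivation K R R) (z : Derivation K R R))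

/-- `FL` is a Lie algebra over the field `F = R^L`. -/
instance constSpanLieAlgebra (L : LieSubalgebra K (Derivation K R R)) :
    LieAlgebra (constants L) (constSpan L) where
  lie_smul a x y := Subtype.ext (lie_const_smul L x.2 a y)

end Constants

section Triangular

open MvPolynomial

/-- For `D = ∑ i, f i ∂/∂x_i` one has `f i = D (x_i)`. -/
theorem exists_triangular_iff {F : Type*} [Field F] {n : ℕ}
    (D : Derivation F (MvPolynomial (Fin n) F) (MvPolynomial (Fin n) F)) :
    (∃ f : Fin n → MvPolynomial (Fin n) F,
      (∀ i, f i ∈ supported F {j : Fin n | i < j}) ∧ D = ∑ i, f i • pderiv i) ↔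
    ∀ i, D (X i) ∈ supported F {j : Fin n | i < j} := by
  have ev : ∀ (f : Fin n → MvPolynomial (Fin n) F) (i : Fin n),
      (∑ j, f j • (pderiv j : Derivation F (MvPolynomial (Fin n) F) _)) (X i) = f i := by
    intro f i
    rw [← Derivation.coeFnAddMonoidHom_apply, map_sum, Finset.sum_apply]
    simp [Derivation.coeFnAddMonoidHom_apply, pderiv_X, Pi.single_apply]
  constructor
  · rintro ⟨f, hf, rfl⟩ i
    rw [ev]
    exact hf i
  · intro h
    refine ⟨fun i => D (X i), h, derivation_ext fun i => ?_⟩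
    rw [ev]

/-- A triangular derivation maps `F[x_j, j > i]` to itself. -/
theorem triangular_apply_mem {F : Type*} [Field F] {n : ℕ}
    {D : Derivation F (MvPolynomial (Fin n) F) (MvPolynomial (Fin n) F)}
    (h : ∀ i, D (X i) ∈ supported F {j : Fin n | i < j}) (i : Fin n)
    {p : MvPolynomial (Fin n) F} (hp : p ∈ supported F {j : Fin n | i < j}) :
    D p ∈ supported F {j : Fin n | i < j} := by
  rw [supported_eq_adjoin_X] at hp
  refine Algebra.adjoin_induction
    (p := fun q _ => D q ∈ supported F {j : Fin n | i < j}) ?_ ?_ ?_ ?_ hp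
  · intro x hx
    rw [Set.mem_image] at hx
    obtain ⟨j, hj, hx⟩ := hx
    rw [← hx]
    have hsub : {k : Fin n | j < k} ⊆ {k : Fin n | i < k} := fun k hk => by
      rw [Set.mem_ofPred_eq] at hj hk ⊢
      exact lt_trans hj hk
    exact (supported_mono (R := F) hsub : _) (h j)
  · intro r
    rw [Derivation.map_algebraMap]
    exact Subalgebra.zero_mem _
  · intro x y _ _ hx hy
    rw [map_add]
    exact Subalgebra.add_mem _ hx hy
  · intro x y hx' hy' hx hy
    rw [← supported_eq_adjoin_X] at hx' hy'
    rw [Derivation.leibniz, smul_eq_mul, smul_eq_mul]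
    exact Subalgebra.add_mem _ (Subalgebra.mul_mem _ hx' hy) (Subalgebra.mul_mem _ hy' hx)

/-- The triangular Lie algebra `u_n(F)`: all derivations `∑ i, f i ∂/∂x_i` of
`F[x_1, …, x_n]` whose coefficient `f i` is a polynomial in the variables after `x_i` only
(so the last coefficient is a constant). -/
noncomputable def triangular (F : Type*) [Field F] (n : ℕ) :
    LieSubalgebra F (Derivation F (MvPolynomial (Fin n) F) (MvPolynomial (Fin n) F)) where
  carrier := {D | ∃ f : Fin n → MvPolynomial (Fin n) F,
    (∀ i, f i ∈ supported F {j : Fin n | i < j}) ∧ D = ∑ i, f i • pderiv i}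
  add_mem' := fun {D E} hD hE => by
    change ∃ f : Fin n → MvPolynomial (Fin n) F, _ at hD hE
    change ∃ f : Fin n → MvPolynomial (Fin n) F, _
    rw [exists_triangular_iff] at hD hE ⊢
    exact fun i => Subalgebra.add_mem _ (hD i) (hE i)
  zero_mem' := by
    change ∃ f : Fin n → MvPolynomial (Fin n) F, _
    rw [exists_triangular_iff]
    exact fun i => Subalgebra.zero_mem _
  smul_mem' := fun c D hD => by
    change ∃ f : Fin n → MvPolynomial (Fin n) F, _ at hD
    change ∃ f : Fin n → MvPolynomial (Fin n) F, _
    rw [exists_triangular_iff] at hD ⊢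
    exact fun i => Subalgebra.smul_mem _ (hD i) c
  lie_mem' := fun {D E} hD hE => by
    change ∃ f : Fin n → MvPolynomial (Fin n) F, _ at hD hE
    change ∃ f : Fin n → MvPolynomial (Fin n) F, _
    rw [exists_triangular_iff] at hD hE ⊢
    intro i
    rw [Derivation.commutator_apply]
    exact Subalgebra.sub_mem _ (triangular_apply_mem hD i (hE i))
      (triangular_apply_mem hE i (hD i))

end Triangular

end FractionFieldDerivations

/-!
Write `F` for the field of constants of `L` and `k` for its rank.

A nilpotent `L` has a flag: elements `D 0, …, D (k - 1)` of `FL`, a basis of `RL` over `R`, such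
that every bracket `[X, D j]` with `X` in `FL` is an `R`-combination of the earlier `D i`
(`exists_frame`). An element of `FL` that commutes with all `D j` has a constant leading
coordinate, so the centralizer of the flag is finite-dimensional over `F`, and descending induction
along the lower central series shows that `FL` is (`Frame.finiteDimensional`).

Let `k = 3`. The flag conditions leave `[D 2, D 1] = c D 0` as the only nonzero bracket of the
`D i`. For `Y = s D 0 + r D 1 + e D 2` in `FL` they give `e ∈ F` and `D 0 r = D 1 r = D 0 s = 0`,
and nilpotency, applied to iterated brackets with `D 1` and `D 2`, shows that `s`, `r` and `c` lie
in the algebra `B` of all `f` with `D 0 f = 0` on which `D 1` and `D 2` act nilpotently. On `B` the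
derivations `D 1` and `D 2` commute and their common kernel is `F`. Such a `B` has an `F`-point:
where the derivations do not vanish they have slices, and the Dixmier maps evaluate at the zero of
these slices (`LocallyNilpotent.exists_algHom_base`). Taylor expansion at that point is an injective
homomorphism `τ` from `B` to polynomials that turns `D 1`, `D 2` into partial derivatives
(`LocallyNilpotent.exists_taylor_algHom`). Choosing a polynomial `H` with `∂₂ H = τ c`, the map
`s D 0 + r D 1 + e D 2 ↦ (τ s + H τ r) ∂₀ + τ r ∂₁ + e ∂₂` is an injective homomorphism into
`u_3(F)`. For `k = 2` the same argument works without `r` and `c`, and for `k ≤ 1` the coordinates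
are constants. No coordinate functions in `R` itself are used; they need not exist there.
-/

/-! ### Exponentials of locally nilpotent derivations -/

namespace LocallyNilpotent

open Polynomial

section Taylor

variable {F B : Type*} [Field F] [CommRing B] [Algebra F B]

theorem iterate_eq_zero_of_le (D : Derivation F B B) {f : B} {m n : ℕ} (hmn : m ≤ n)
    (hf : D^[m] f = 0) : D^[n] f = 0 := by
  obtain ⟨d, rfl⟩ := Nat.exists_eq_add_of_le' hmn
  rw [Function.iterate_add_apply, hf, iterate_map_zero]

theorem iterate_comm {D E : Derivation F B B} (hcomm : ∀ f, D (E f) = E (D f)) (n : ℕ) (f : B) :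
    D (E^[n] f) = E^[n] (D f) := by
  induction n generalizing f with
  | zero => rfl
  | succ n ih => rw [Function.iterate_succ_apply, ih, hcomm, Function.iterate_succ_apply]

open Classical in
/-- The Taylor expansion `exp(X D) f = ∑ n, (Dⁿ f / n!) Xⁿ` of `f` along a locally nilpotent
derivation `D`; the sum stops at the first `n` with `Dⁿ f = 0`. -/
noncomputable def taylorPoly (D : Derivation F B B) (h : ∀ f, ∃ n, D^[n] f = 0) (f : B) : B[X] :=
  ∑ n ∈ Finset.range (Nat.find (h f)), monomial n ((n.factorial : F)⁻¹ • D^[n] f)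

theorem coeff_taylorPoly (D : Derivation F B B) (h : ∀ f, ∃ n, D^[n] f = 0) (f : B) (n : ℕ) :
    (taylorPoly D h f).coeff n = (n.factorial : F)⁻¹ • D^[n] f := by
  classical
  simp only [taylorPoly, finsetSum_coeff, coeff_monomial, Finset.sum_ite_eq', Finset.mem_range]
  split_ifs with hn
  · rfl
  · rw [iterate_eq_zero_of_le D (not_lt.mp hn) (Nat.find_spec (h f)), smul_zero]

variable [CharZero F]

theorem derivative_taylorPoly (D : Derivation F B B) (h : ∀ f, ∃ n, D^[n] f = 0) (f : B) :
    derivative (taylorPoly D h f) = taylorPoly D h (D f) := by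
  ext n
  have hn : ((n : F) + 1) ≠ 0 := by exact_mod_cast Nat.succ_ne_zero n
  have hfac : (n.factorial : F) ≠ 0 := by exact_mod_cast n.factorial_ne_zero
  have hcast : ((n : B) + 1) = algebraMap F B ((n : F) + 1) := by simp
  rw [coeff_derivative, coeff_taylorPoly, coeff_taylorPoly, hcast, mul_comm, ← Algebra.smul_def,
    smul_smul, Function.iterate_succ_apply, Nat.factorial_succ]
  congr 1
  push_cast
  field_simp

theorem taylorPoly_mul (D : Derivation F B B) (h : ∀ f, ∃ n, D^[n] f = 0) (f g : B) :
    taylorPoly D h (f * g) = taylorPoly D h f * taylorPoly D h g := by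
  have add (f g : B) : taylorPoly D h (f + g) = taylorPoly D h f + taylorPoly D h g := by
    ext n
    simp [coeff_taylorPoly, iterate_map_add]
  ext n
  -- both sides have the same derivative up to lower coefficients, and the same value at `0`
  induction n generalizing f g with
  | zero => simp [mul_coeff_zero, coeff_taylorPoly]
  | succ n ih =>
    have hn : ((n : F) + 1) ≠ 0 := by exact_mod_cast Nat.succ_ne_zero n
    have hcast : ((n : B) + 1) = algebraMap F B ((n : F) + 1) := by simp
    have key : (derivative (taylorPoly D h (f * g))).coeff n =
        (derivative (taylorPoly D h f * taylorPoly D h g)).coeff n := by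
      rw [derivative_mul, derivative_taylorPoly, derivative_taylorPoly, derivative_taylorPoly,
        Derivation.leibniz, add, coeff_add, coeff_add, smul_eq_mul, smul_eq_mul, ih, ih,
        add_comm, mul_comm (taylorPoly D h g)]
    rw [coeff_derivative, coeff_derivative, hcast, ← Algebra.commutes, ← Algebra.commutes,
      ← Algebra.smul_def, ← Algebra.smul_def] at key
    exact (IsUnit.mk0 _ hn).smul_left_cancel.mp key

/-- The Taylor expansion along a locally nilpotent derivation, as an algebra homomorphism. -/
noncomputable def taylorHom (D : Derivation F B B) (h : ∀ f, ∃ n, D^[n] f = 0) :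
    B →ₐ[F] B[X] where
  toFun := taylorPoly D h
  map_one' := by
    ext n
    rw [coeff_taylorPoly]
    cases n with
    | zero => simp
    | succ n => simp [Function.iterate_succ_apply, coeff_one, iterate_map_zero]
  map_mul' := taylorPoly_mul D h
  map_zero' := by
    ext n
    simp [coeff_taylorPoly, iterate_map_zero]
  map_add' f g := by
    ext n
    simp [coeff_taylorPoly, iterate_map_add]
  commutes' r := by
    ext n
    rw [coeff_taylorPoly]
    cases n with
    | zero => simp [Polynomial.algebraMap_apply]
    | succ n =>
      simp [Function.iterate_succ_apply, Polynomial.algebraMap_apply, iterate_map_zero]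

variable {M : Type*} [CommRing M] [Algebra F M]

/-- The homomorphism `f ↦ ∑ n, lam (Dⁿ f) xⁿ / n!` attached to a locally nilpotent derivation `D`
of `B`, a homomorphism `lam : B → M` and a point `x` of `M`. -/
noncomputable def expHom (lam : B →ₐ[F] M) (D : Derivation F B B)
    (h : ∀ f, ∃ n, D^[n] f = 0) (x : M) : B →ₐ[F] M :=
  ((aeval x).restrictScalars F).comp ((mapAlgHom lam).comp (taylorHom D h))

variable (lam : B →ₐ[F] M) (D : Derivation F B B) (h : ∀ f, ∃ n, D^[n] f = 0) (x : M)

theorem expHom_apply {f : B} {N : ℕ} (hN : D^[N] f = 0) :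
    expHom lam D h x f =
      ∑ n ∈ Finset.range N, (n.factorial : F)⁻¹ • (lam (D^[n] f) * x ^ n) := by
  rcases N.eq_zero_or_pos with rfl | hpos
  · obtain rfl : f = 0 := hN
    simp
  have hdeg : ((taylorPoly D h f).map lam.toRingHom).natDegree < N := by
    refine Nat.lt_of_le_pred hpos (natDegree_le_iff_coeff_eq_zero.mpr fun m hm => ?_)
    replace hm : N ≤ m := Nat.le_of_pred_lt hm
    rw [coeff_map, coeff_taylorPoly, iterate_eq_zero_of_le D hm hN]
    simp
  change (aeval x) ((taylorPoly D h f).map lam.toRingHom) = _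
  rw [aeval_def, eval₂_eq_sum_range' (algebraMap M M) hdeg]
  refine Finset.sum_congr rfl fun n _ => ?_
  simp [coeff_taylorPoly]

theorem expHom_of_apply_eq_zero {f : B} (hf : D f = 0) : expHom lam D h x f = lam f := by
  rw [expHom_apply lam D h x (N := 1) (by simpa using hf)]
  simp

theorem expHom_mem {S : Subalgebra F M} (hlam : ∀ f, lam f ∈ S) (hx : x ∈ S) (f : B) :
    expHom lam D h x f ∈ S := by
  obtain ⟨N, hN⟩ := h f
  rw [expHom_apply lam D h x hN]
  exact S.sum_mem fun n _ => S.smul_mem (S.mul_mem (hlam _) (S.pow_mem hx n)) _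

/-- The chain rule for `expHom`. -/
theorem derivation_expHom {Δ : Derivation F B B} {d : Derivation F M M} {c : M}
    (hcomm : ∀ f, Δ (D f) = D (Δ f)) (hd : ∀ f, d (lam f) = c * lam (Δ f)) (f : B) :
    d (expHom lam D h x f) = c * expHom lam D h x (Δ f) + d x * expHom lam D h x (D f) := by
  obtain ⟨N, hN⟩ := h f
  have h1 : D^[N + 1] f = 0 := iterate_eq_zero_of_le D N.le_succ hN
  have h2 : D^[N + 1] (Δ f) = 0 := by rw [← iterate_comm hcomm, h1, map_zero]
  have h3 : D^[N] (D f) = 0 := by rw [← Function.iterate_succ_apply, h1]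
  rw [expHom_apply lam D h x h1, expHom_apply lam D h x h2, expHom_apply lam D h x h3, map_sum,
    Finset.mul_sum, Finset.mul_sum]
  have hterm (n : ℕ) : d ((n.factorial : F)⁻¹ • (lam (D^[n] f) * x ^ n)) =
      c * (n.factorial : F)⁻¹ • (lam (D^[n] (Δ f)) * x ^ n) +
      (n.factorial : F)⁻¹ • (lam (D^[n] f) * (n * x ^ (n - 1) * d x)) := by
    rw [Derivation.map_smul, Derivation.leibniz, Derivation.leibniz_pow, hd, iterate_comm hcomm]
    simp only [smul_eq_mul, nsmul_eq_mul]
    simp only [Algebra.smul_def]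
    ring
  rw [Finset.sum_congr rfl fun n _ => hterm n, Finset.sum_add_distrib]
  congr 1
  rw [Finset.sum_range_succ']
  simp only [Nat.cast_zero, zero_mul, mul_zero, smul_zero, add_zero]
  refine Finset.sum_congr rfl fun n _ => ?_
  have hn : ((n : F) + 1) ≠ 0 := by exact_mod_cast Nat.succ_ne_zero n
  have hfac : (n.factorial : F) ≠ 0 := by exact_mod_cast n.factorial_ne_zero
  have hcast : (((n + 1 : ℕ) : M)) = algebraMap F M ((n : F) + 1) := by simp
  have hsc : (((n + 1).factorial : F))⁻¹ * ((n : F) + 1) = (n.factorial : F)⁻¹ := by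
    rw [Nat.factorial_succ]
    push_cast
    field_simp
  rw [← hsc, hcast, Function.iterate_succ_apply, Nat.add_sub_cancel]
  simp only [Algebra.smul_def, map_mul]
  ring

end Taylor

end LocallyNilpotent

/-! ### Polynomial models of algebras with two commuting locally nilpotent derivations -/

namespace LocallyNilpotent

variable {F B : Type*} [Field F] [CommRing B] [Algebra F B]

/-- The last nonzero iterate of a locally nilpotent derivation is a constant. -/
theorem exists_iterate_ne_zero (D : Derivation F B B) (h : ∀ f, ∃ n, D^[n] f = 0) {f : B}
    (hf : f ≠ 0) : ∃ n, D^[n] f ≠ 0 ∧ D (D^[n] f) = 0 := by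
  classical
  have hpos : Nat.find (h f) ≠ 0 := fun h0 => hf (by simpa [h0] using Nat.find_spec (h f))
  obtain ⟨n, hn⟩ := Nat.exists_eq_succ_of_ne_zero hpos
  refine ⟨n, Nat.find_min (h f) (by omega), ?_⟩
  rw [← Function.iterate_succ_apply' (⇑D) n f, ← hn]
  exact Nat.find_spec (h f)

variable {D₁ D₂ : Derivation F B B} (h₁ : ∀ f, ∃ n, D₁^[n] f = 0) (h₂ : ∀ f, ∃ n, D₂^[n] f = 0)
  (hcomm : ∀ f, D₁ (D₂ f) = D₂ (D₁ f))
  (hconst : ∀ f, D₁ f = 0 → D₂ f = 0 → ∃ r : F, algebraMap F B r = f)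

include h₁ h₂ hcomm hconst

/-- If `D₁ ≠ 0`, then `D₁` has a slice. -/
theorem exists_slice_left (hD : ∃ f, D₁ f ≠ 0) : ∃ b, D₁ b = 1 := by
  obtain ⟨f, hf⟩ := hD
  obtain ⟨n, hn, hn'⟩ := exists_iterate_ne_zero D₁ h₁ hf
  obtain ⟨m, hm, hm'⟩ := exists_iterate_ne_zero D₂ h₂ hn
  obtain ⟨r, hr⟩ := hconst (D₂^[m] (D₁^[n] (D₁ f)))
    (by rw [iterate_comm hcomm, hn', iterate_map_zero]) hm'
  have hr0 : r ≠ 0 := by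
    rintro rfl
    exact hm (by rw [← hr, map_zero])
  refine ⟨r⁻¹ • D₂^[m] (D₁^[n] f), ?_⟩
  rw [Derivation.map_smul, iterate_comm hcomm, ← Function.iterate_succ_apply' (⇑D₁) n f,
    Function.iterate_succ_apply, ← hr, Algebra.smul_def, ← map_mul, inv_mul_cancel₀ hr0, map_one]

omit h₁ in
/-- If `D₂` does not vanish on the kernel of `D₁`, then it has a slice there. -/
theorem exists_slice_right (hD : ∃ f, D₁ f = 0 ∧ D₂ f ≠ 0) : ∃ a, D₁ a = 0 ∧ D₂ a = 1 := by
  obtain ⟨f, hf1, hf⟩ := hD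
  obtain ⟨n, hn, hn'⟩ := exists_iterate_ne_zero D₂ h₂ hf
  obtain ⟨r, hr⟩ := hconst (D₂^[n] (D₂ f))
    (by rw [iterate_comm hcomm, hcomm, hf1, map_zero, iterate_map_zero]) hn'
  have hr0 : r ≠ 0 := by
    rintro rfl
    exact hn (by rw [← hr, map_zero])
  refine ⟨r⁻¹ • D₂^[n] f, ?_, ?_⟩
  · rw [Derivation.map_smul, iterate_comm hcomm, hf1, iterate_map_zero, smul_zero]
  · rw [Derivation.map_smul, ← Function.iterate_succ_apply' (⇑D₂) n f,
      Function.iterate_succ_apply, ← hr, Algebra.smul_def, ← map_mul, inv_mul_cancel₀ hr0, map_one]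

variable [CharZero F] [Nontrivial B]

/-- There is an `F`-rational point: evaluate at the origin of the coordinates given by slices,
that is, apply the Dixmier maps `f ↦ ∑ n, (-b)ⁿ / n! Dⁿ f` of both derivations. -/
theorem exists_algHom_base : Nonempty (B →ₐ[F] F) := by
  obtain ⟨π₁, hπ₁⟩ : ∃ π₁ : B →ₐ[F] B, ∀ f, D₁ (π₁ f) = 0 := by
    by_cases hD : ∃ f, D₁ f ≠ 0
    · obtain ⟨b, hb⟩ := exists_slice_left h₁ h₂ hcomm hconst hD
      refine ⟨expHom (AlgHom.id F B) D₁ h₁ (-b), fun f => ?_⟩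
      rw [derivation_expHom (AlgHom.id F B) D₁ h₁ (-b) (Δ := D₁) (c := 1) (fun _ => rfl)
        (fun _ => (one_mul _).symm),
        map_neg, hb]
      ring
    · exact ⟨AlgHom.id F B, fun f => not_not.mp fun hf => hD ⟨f, hf⟩⟩
  obtain ⟨π₂, hπ₂, hπ₂'⟩ : ∃ π₂ : B →ₐ[F] B, (∀ f, D₁ f = 0 → D₁ (π₂ f) = 0) ∧
      ∀ f, D₁ f = 0 → D₂ (π₂ f) = 0 := by
    by_cases hD : ∃ f, D₁ f = 0 ∧ D₂ f ≠ 0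
    · obtain ⟨a, ha, ha'⟩ := exists_slice_right h₂ hcomm hconst hD
      refine ⟨expHom (AlgHom.id F B) D₂ h₂ (-a), fun f hf => ?_, fun f _ => ?_⟩
      · rw [derivation_expHom (AlgHom.id F B) D₂ h₂ (-a) (Δ := D₁) (c := 1) hcomm
          (fun _ => (one_mul _).symm),
          map_neg, ha, hf]
        simp
      · rw [derivation_expHom (AlgHom.id F B) D₂ h₂ (-a) (Δ := D₂) (c := 1) (fun _ => rfl)
        (fun _ => (one_mul _).symm),
          map_neg, ha']
        ring
    · exact ⟨AlgHom.id F B, fun f hf => hf, fun f hf => not_not.mp fun hf' => hD ⟨f, hf, hf'⟩⟩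
  have hmem (f : B) : π₂ (π₁ f) ∈ (⊥ : Subalgebra F B) :=
    Algebra.mem_bot.mpr (hconst _ (hπ₂ _ (hπ₁ f)) (hπ₂' _ (hπ₁ f)))
  exact ⟨(Algebra.botEquivOfInjective (algebraMap F B).injective).toAlgHom.comp
    ((π₂.comp π₁).codRestrict ⊥ hmem)⟩

/-- Let `D₁`, `D₂` be commuting locally nilpotent derivations of `B` with common kernel `F`. For
every choice of `x₁`, `x₂` in an `F`-algebra `M`, Taylor expansion at an `F`-rational point gives
a homomorphism `B → M` satisfying the chain rule; it is the analogue of writing a function in the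
coordinates `x₁`, `x₂` dual to `D₁`, `D₂`. -/
theorem exists_taylor_algHom {M : Type*} [CommRing M] [Algebra F M] (x₁ x₂ : M) :
    ∃ τ : B →ₐ[F] M,
      (∀ (d : Derivation F M M) f, d (τ f) = d x₁ * τ (D₁ f) + d x₂ * τ (D₂ f)) ∧
      (∀ S : Subalgebra F M, x₁ ∈ S → x₂ ∈ S → ∀ f, τ f ∈ S) ∧
      (∀ S : Subalgebra F M, x₂ ∈ S → ∀ f, D₁ f = 0 → τ f ∈ S) := by
  obtain ⟨ε⟩ := exists_algHom_base h₁ h₂ hcomm hconst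
  let lam : B →ₐ[F] M := (Algebra.ofId F M).comp ε
  have hlam (S : Subalgebra F M) (f : B) : lam f ∈ S := S.algebraMap_mem (ε f)
  refine ⟨expHom (expHom lam D₂ h₂ x₂) D₁ h₁ x₁, fun d f => ?_, fun S hx₁ hx₂ f => ?_,
    fun S hx₂ f hf => ?_⟩
  · have hd (f : B) : d (expHom lam D₂ h₂ x₂ f) = d x₂ * expHom lam D₂ h₂ x₂ (D₂ f) := by
      rw [derivation_expHom lam D₂ h₂ x₂ (Δ := 0) (c := 0) (fun f => by simp)
        (fun f => by simp [lam, Algebra.ofId_apply])]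
      ring
    rw [derivation_expHom _ D₁ h₁ x₁ (fun f => (hcomm f).symm) hd, add_comm]
  · exact expHom_mem _ _ _ _ (expHom_mem _ _ _ _ (hlam S) hx₂) hx₁ f
  · rw [expHom_of_apply_eq_zero _ _ _ _ hf]
    exact expHom_mem _ _ _ _ (hlam S) hx₂ f

omit [CharZero F] [Nontrivial B] in
/-- A homomorphism whose kernel is stable under both derivations is injective. -/
theorem injective_of_ker_stable {M : Type*} [CommRing M] [Nontrivial M] [Algebra F M]
    (τ : B →ₐ[F] M) (hs₁ : ∀ f, τ f = 0 → τ (D₁ f) = 0) (hs₂ : ∀ f, τ f = 0 → τ (D₂ f) = 0) :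
    Function.Injective τ := by
  rw [injective_iff_map_eq_zero]
  intro f hf
  by_contra hne
  have it (D : Derivation F B B) (hs : ∀ f, τ f = 0 → τ (D f) = 0) (n : ℕ) (f : B)
      (hf : τ f = 0) : τ (D^[n] f) = 0 := by
    induction n with
    | zero => exact hf
    | succ n ih => rw [Function.iterate_succ_apply']; exact hs _ ih
  obtain ⟨n, hn, hn'⟩ := exists_iterate_ne_zero D₁ h₁ hne
  obtain ⟨m, hm, hm'⟩ := exists_iterate_ne_zero D₂ h₂ hn
  obtain ⟨r, hr⟩ := hconst (D₂^[m] (D₁^[n] f))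
    (by rw [iterate_comm hcomm, hn', iterate_map_zero]) hm'
  have h0 : algebraMap F M r = 0 := by
    rw [← τ.commutes, hr]
    exact it D₂ hs₂ m _ (it D₁ hs₁ n f hf)
  apply hm
  rw [← hr, (map_eq_zero _).mp h0, map_zero]

end LocallyNilpotent

/-! ### The subalgebra of nilpotent elements -/

namespace LocallyNilpotent

variable {F R : Type*} [Field F] [CommRing R] [Algebra F R]

theorem iterate_mul_eq_zero (D : Derivation F R R) (m n : ℕ) {f g : R} (hf : D^[m] f = 0)
    (hg : D^[n] g = 0) : D^[m + n] (f * g) = 0 := by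
  induction h : m + n generalizing m n f g with
  | zero =>
    obtain ⟨rfl, rfl⟩ : m = 0 ∧ n = 0 := by omega
    obtain rfl : f = 0 := hf
    simp
  | succ N ih =>
    rw [Function.iterate_succ_apply, Derivation.leibniz, iterate_map_add, smul_eq_mul, smul_eq_mul]
    have h1 : D^[N] (f * D g) = 0 := by
      cases n with
      | zero =>
        obtain rfl : g = 0 := hg
        simp [iterate_map_zero]
      | succ n => exact ih m n hf hg (by omega)
    have h2 : D^[N] (g * D f) = 0 := by
      cases m with
      | zero =>
        obtain rfl : f = 0 := hf
        simp [iterate_map_zero]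
      | succ m => exact ih n m hg hf (by omega)
    rw [h1, h2, add_zero]

/-- The subalgebra of elements killed by `Δ₀` on which `Δ₁` and `Δ₂` act nilpotently. -/
def nilSubalgebra (Δ₀ Δ₁ Δ₂ : Derivation F R R) : Subalgebra F R where
  carrier := {f | Δ₀ f = 0 ∧ (∃ n, Δ₁^[n] f = 0) ∧ ∃ n, Δ₂^[n] f = 0}
  mul_mem' := fun {f g} ⟨h0, ⟨m₁, h1⟩, ⟨m₂, h2⟩⟩ ⟨h0', ⟨n₁, h1'⟩, ⟨n₂, h2'⟩⟩ =>
    ⟨by simp [h0, h0'], ⟨_, iterate_mul_eq_zero Δ₁ _ _ h1 h1'⟩,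
      ⟨_, iterate_mul_eq_zero Δ₂ _ _ h2 h2'⟩⟩
  add_mem' := fun {f g} ⟨h0, ⟨m₁, h1⟩, ⟨m₂, h2⟩⟩ ⟨h0', ⟨n₁, h1'⟩, ⟨n₂, h2'⟩⟩ => by
    refine ⟨by simp [h0, h0'], ⟨m₁ + n₁, ?_⟩, ⟨m₂ + n₂, ?_⟩⟩
    · rw [iterate_map_add, iterate_eq_zero_of_le Δ₁ (Nat.le_add_right _ _) h1,
        iterate_eq_zero_of_le Δ₁ (Nat.le_add_left _ _) h1', add_zero]
    · rw [iterate_map_add, iterate_eq_zero_of_le Δ₂ (Nat.le_add_right _ _) h2,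
        iterate_eq_zero_of_le Δ₂ (Nat.le_add_left _ _) h2', add_zero]
  algebraMap_mem' := fun r => ⟨by simp, ⟨1, by simp⟩, ⟨1, by simp⟩⟩

variable {Δ₀ Δ₁ Δ₂ : Derivation F R R}

theorem mem_nilSubalgebra_of_apply_mem {f : R} (h0 : Δ₀ f = 0)
    (h1 : Δ₁ f ∈ nilSubalgebra Δ₀ Δ₁ Δ₂) (h2 : Δ₂ f ∈ nilSubalgebra Δ₀ Δ₁ Δ₂) :
    f ∈ nilSubalgebra Δ₀ Δ₁ Δ₂ := by
  obtain ⟨-, ⟨m, hm⟩, -⟩ := h1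
  obtain ⟨-, -, ⟨n, hn⟩⟩ := h2
  exact ⟨h0, ⟨m + 1, hm⟩, ⟨n + 1, hn⟩⟩

/-- The restriction of a derivation to a stable subalgebra. -/
def restrictDerivation (D : Derivation F R R) (S : Subalgebra F R) (h : ∀ f ∈ S, D f ∈ S) :
    Derivation F S S :=
  Derivation.mk' ((D.toLinearMap.restrict (p := S.toSubmodule) (q := S.toSubmodule) h))
    fun f g => Subtype.ext (D.leibniz (f : R) (g : R))

theorem coe_iterate_restrictDerivation (D : Derivation F R R) (S : Subalgebra F R)
    (h : ∀ f ∈ S, D f ∈ S) (n : ℕ) (f : S) :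
    (((restrictDerivation D S h)^[n] f : S) : R) = D^[n] f := by
  induction n generalizing f with
  | zero => rfl
  | succ n ih => rw [Function.iterate_succ_apply, ih, Function.iterate_succ_apply]; rfl

/-- Suppose that `Δ₁` and `Δ₂` preserve the kernel of `Δ₀` and commute on it, and that the
common kernel of the three derivations is `F`. Then `nilSubalgebra Δ₀ Δ₁ Δ₂` has a Taylor
homomorphism to every `F`-algebra with two chosen elements `x₁`, `x₂`. -/
theorem exists_taylor_nilSubalgebra [CharZero F] [Nontrivial R]
    (h01 : ∀ f, Δ₀ f = 0 → Δ₀ (Δ₁ f) = 0) (h02 : ∀ f, Δ₀ f = 0 → Δ₀ (Δ₂ f) = 0)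
    (h12 : ∀ f, Δ₀ f = 0 → Δ₁ (Δ₂ f) = Δ₂ (Δ₁ f))
    (hconst : ∀ f, Δ₀ f = 0 → Δ₁ f = 0 → Δ₂ f = 0 → ∃ r : F, algebraMap F R r = f)
    {M : Type*} [CommRing M] [Nontrivial M] [Algebra F M] (x₁ x₂ : M) :
    ∃ (D₁ D₂ : Derivation F (nilSubalgebra Δ₀ Δ₁ Δ₂) (nilSubalgebra Δ₀ Δ₁ Δ₂))
      (τ : nilSubalgebra Δ₀ Δ₁ Δ₂ →ₐ[F] M),
      (∀ f, (D₁ f : R) = Δ₁ f) ∧ (∀ f, (D₂ f : R) = Δ₂ f) ∧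
      (∀ (d : Derivation F M M) f, d (τ f) = d x₁ * τ (D₁ f) + d x₂ * τ (D₂ f)) ∧
      (∀ S : Subalgebra F M, x₁ ∈ S → x₂ ∈ S → ∀ f, τ f ∈ S) ∧
      (∀ S : Subalgebra F M, x₂ ∈ S → ∀ f, D₁ f = 0 → τ f ∈ S) ∧
      ((∀ f, τ f = 0 → τ (D₁ f) = 0) → (∀ f, τ f = 0 → τ (D₂ f) = 0) →
        Function.Injective τ) := by
  have it12 (n : ℕ) (f : R) (hf : Δ₀ f = 0) : Δ₁ (Δ₂^[n] f) = Δ₂^[n] (Δ₁ f) := by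
    induction n generalizing f with
    | zero => rfl
    | succ n ih =>
      rw [Function.iterate_succ_apply, ih _ (h02 f hf), h12 f hf, Function.iterate_succ_apply]
  have it21 (n : ℕ) (f : R) (hf : Δ₀ f = 0) : Δ₂ (Δ₁^[n] f) = Δ₁^[n] (Δ₂ f) := by
    induction n generalizing f with
    | zero => rfl
    | succ n ih =>
      rw [Function.iterate_succ_apply, ih _ (h01 f hf), ← h12 f hf, Function.iterate_succ_apply]
  have st1 : ∀ f ∈ nilSubalgebra Δ₀ Δ₁ Δ₂, Δ₁ f ∈ nilSubalgebra Δ₀ Δ₁ Δ₂ := by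
    rintro f ⟨h0, ⟨m, hm⟩, ⟨n, hn⟩⟩
    refine ⟨h01 f h0, ⟨m, ?_⟩, ⟨n, ?_⟩⟩
    · rw [← Function.iterate_succ_apply, Function.iterate_succ_apply' (⇑Δ₁), hm, map_zero]
    · rw [← it12 n f h0, hn, map_zero]
  have st2 : ∀ f ∈ nilSubalgebra Δ₀ Δ₁ Δ₂, Δ₂ f ∈ nilSubalgebra Δ₀ Δ₁ Δ₂ := by
    rintro f ⟨h0, ⟨m, hm⟩, ⟨n, hn⟩⟩
    refine ⟨h02 f h0, ⟨m, ?_⟩, ⟨n, ?_⟩⟩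
    · rw [← it21 m f h0, hm, map_zero]
    · rw [← Function.iterate_succ_apply, Function.iterate_succ_apply' (⇑Δ₂), hn, map_zero]
  have n1 : ∀ f, ∃ n, (restrictDerivation Δ₁ _ st1)^[n] f = 0 := fun f => by
    obtain ⟨n, hn⟩ := f.2.2.1
    exact ⟨n, Subtype.ext (by rw [coe_iterate_restrictDerivation, hn]; rfl)⟩
  have n2 : ∀ f, ∃ n, (restrictDerivation Δ₂ _ st2)^[n] f = 0 := fun f => by
    obtain ⟨n, hn⟩ := f.2.2.2
    exact ⟨n, Subtype.ext (by rw [coe_iterate_restrictDerivation, hn]; rfl)⟩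
  have hcomm : ∀ f, restrictDerivation Δ₁ _ st1 (restrictDerivation Δ₂ _ st2 f) =
      restrictDerivation Δ₂ _ st2 (restrictDerivation Δ₁ _ st1 f) := fun f =>
    Subtype.ext (h12 f f.2.1)
  have hker : ∀ f, restrictDerivation Δ₁ _ st1 f = 0 → restrictDerivation Δ₂ _ st2 f = 0 →
      ∃ r : F, algebraMap F (nilSubalgebra Δ₀ Δ₁ Δ₂) r = f := fun f hf1 hf2 => by
    obtain ⟨r, hr⟩ := hconst f f.2.1 (congrArg Subtype.val hf1) (congrArg Subtype.val hf2)
    exact ⟨r, Subtype.ext hr⟩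
  obtain ⟨τ, hτ, hS, hS'⟩ := exists_taylor_algHom n1 n2 hcomm hker x₁ x₂
  exact ⟨_, _, τ, fun _ => rfl, fun _ => rfl, hτ, hS, hS',
    injective_of_ker_stable n1 n2 hcomm hker τ⟩

end LocallyNilpotent

/-! ### Lie algebras of triangular derivations from coefficient data -/

namespace FractionFieldDerivations

open MvPolynomial

/-- A Lie algebra `g` embeds into `u_n(F)` as soon as it carries a family of injective triangular
coefficients `P` that satisfies the bracket formula for derivations `∑ i, P x i ∂/∂x_i`. -/
theorem exists_lieSubalgebra_triangular {F g : Type*} [Field F] [LieRing g] [LieAlgebra F g]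
    [FiniteDimensional F g] {n : ℕ} (P : g →ₗ[F] (Fin n → MvPolynomial (Fin n) F))
    (hsupp : ∀ x i, P x i ∈ supported F {j : Fin n | i < j})
    (hlie : ∀ x y i, P ⁅x, y⁆ i = mkDerivation F (P x) (P y i) - mkDerivation F (P y) (P x i))
    (hinj : ∀ x, P x = 0 → x = 0) :
    ∃ S : LieSubalgebra F (triangular F n),
      FiniteDimensional F S ∧ Nonempty (g ≃ₗ⁅F⁆ S) := by
  let φ : g →ₗ⁅F⁆ triangular F n :=
    { toFun := fun x => ⟨mkDerivation F (P x), by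
        change ∃ f : Fin n → MvPolynomial (Fin n) F, _
        rw [exists_triangular_iff]
        intro i
        rw [mkDerivation_X]
        exact hsupp x i⟩
      map_add' := fun x y => Subtype.ext (derivation_ext fun i => by
        simp [mkDerivation_X])
      map_smul' := fun c x => Subtype.ext (derivation_ext fun i => by
        simp [mkDerivation_X])
      map_lie' := fun {x y} => Subtype.ext (derivation_ext fun i => by
        simp [mkDerivation_X, hlie, Derivation.commutator_apply]) }
  have hφ : Function.Injective φ := by
    rw [injective_iff_map_eq_zero]
    intro x hx
    refine hinj x (funext fun i => ?_)
    have h1 : mkDerivation F (P x) = 0 := congrArg Subtype.val hx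
    simpa [mkDerivation_X] using congrArg (fun D => D (X i)) h1
  let e := LieEquiv.ofInjective φ hφ
  exact ⟨φ.range, Module.Finite.equiv e.toLinearEquiv, ⟨e⟩⟩

/-- In characteristic zero every polynomial has an antiderivative in each variable. -/
theorem pderiv_surjective {F σ : Type*} [Field F] [CharZero F] (i : σ) :
    Function.Surjective (pderiv i : Derivation F (MvPolynomial σ F) (MvPolynomial σ F)) := by
  intro p
  induction p using MvPolynomial.induction_on' with
  | monomial u a =>
    refine ⟨monomial (u + Finsupp.single i 1) (a / ((u i : F) + 1)), ?_⟩
    have hu : ((u i : F) + 1) ≠ 0 := by exact_mod_cast Nat.succ_ne_zero (u i)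
    rw [pderiv_monomial]
    simp [hu]
  | add p q hp hq =>
    obtain ⟨p', rfl⟩ := hp
    obtain ⟨q', rfl⟩ := hq
    exact ⟨p' + q', map_add _ _ _⟩

theorem exists_pderiv_eq_of_mem_supported {F σ : Type*} [Field F] [CharZero F] {s : Set σ} {i : σ}
    (hi : i ∈ s) {p : MvPolynomial σ F} (hp : p ∈ supported F s) :
    ∃ q ∈ supported F s, pderiv i q = p := by
  rw [supported_eq_range_rename] at hp ⊢
  obtain ⟨p', rfl⟩ := hp
  obtain ⟨q', rfl⟩ := pderiv_surjective (⟨i, hi⟩ : s) p'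
  exact ⟨rename Subtype.val q', ⟨q', rfl⟩,
    pderiv_rename Subtype.val_injective (⟨i, hi⟩ : s) q'⟩

end FractionFieldDerivations

/-! ### Flags in nilpotent Lie algebras of derivations -/

namespace FractionFieldDerivations

section Filtration

variable {K R : Type*} [Field K] [Field R] [Algebra K R]
  {L : LieSubalgebra K (Derivation K R R)}

theorem mem_constSpan_of_mem {X : Derivation K R R} (hX : X ∈ L) : X ∈ constSpan L :=
  Submodule.subset_span hX

/-- The `F`-spans in `Der R` of the terms of the lower central series of `L`. -/
def spanLowerCentralSeries (L : LieSubalgebra K (Derivation K R R)) (n : ℕ) :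
    Submodule (constants L) (Derivation K R R) :=
  Submodule.span (constants L)
    (Subtype.val '' (LieModule.lowerCentralSeries ℤ L L n : Set L))

theorem spanLowerCentralSeries_zero : spanLowerCentralSeries L 0 = constSpan L := by
  simp [spanLowerCentralSeries, constSpan]

theorem spanLowerCentralSeries_antitone : Antitone (spanLowerCentralSeries L) := fun _ _ h =>
  Submodule.span_mono (Set.image_mono (LieModule.antitone_lowerCentralSeries ℤ L L h))

theorem spanLowerCentralSeries_le (n : ℕ) : spanLowerCentralSeries L n ≤ constSpan L :=
  spanLowerCentralSeries_zero (L := L) ▸ spanLowerCentralSeries_antitone n.zero_le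

theorem lie_mem_spanLowerCentralSeries_succ {n : ℕ} {X Y : Derivation K R R}
    (hX : X ∈ constSpan L) (hY : Y ∈ spanLowerCentralSeries L n) :
    ⁅X, Y⁆ ∈ spanLowerCentralSeries L (n + 1) := by
  have hY' : Y ∈ constSpan L := spanLowerCentralSeries_le n hY
  have key : ∀ X ∈ L, ⁅X, Y⁆ ∈ spanLowerCentralSeries L (n + 1) := by
    intro X hX
    have hX' := mem_constSpan_of_mem hX
    unfold spanLowerCentralSeries at hY
    induction hY using Submodule.span_induction with
    | mem Z hZ =>
      obtain ⟨Z, hZ, rfl⟩ := hZ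
      refine Submodule.subset_span ⟨⁅(⟨X, hX⟩ : L), Z⁆, ?_, rfl⟩
      rw [LieModule.lowerCentralSeries_succ]
      exact LieSubmodule.lie_mem_lie (LieSubmodule.mem_top _) hZ
    | zero => rw [lie_zero]; exact Submodule.zero_mem _
    | add u v hu' hv' hu hv =>
      rw [lie_add]
      exact Submodule.add_mem _ (hu (spanLowerCentralSeries_le n hu'))
        (hv (spanLowerCentralSeries_le n hv'))
    | smul b Z hZ' ih =>
      rw [lie_const_smul L hX']
      exact Submodule.smul_mem _ _ (ih (spanLowerCentralSeries_le n hZ'))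
  unfold constSpan at hX
  induction hX using Submodule.span_induction with
  | mem X hX => exact key X hX
  | zero => rw [zero_lie]; exact Submodule.zero_mem _
  | add u v _ _ hu hv => rw [add_lie]; exact Submodule.add_mem _ hu hv
  | smul b X _ ih =>
    rw [← lie_skew, lie_const_smul L hY', ← smul_neg, lie_skew]
    exact Submodule.smul_mem _ _ ih

theorem exists_spanLowerCentralSeries_eq_bot (hnil : LieRing.IsNilpotent L) :
    ∃ N, spanLowerCentralSeries L N = ⊥ := by
  obtain ⟨N, hN⟩ := hnil.nilpotent_int
  refine ⟨N, ?_⟩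
  rw [spanLowerCentralSeries, hN]
  simp

/-- Descending induction along the lower central series: a property of elements of `FL` holds
everywhere if it holds for `0` and passes from all brackets `[X, Y]` to `Y`. -/
theorem constSpan_induction (hnil : LieRing.IsNilpotent L) {p : Derivation K R R → Prop}
    (h0 : p 0) (hstep : ∀ Y ∈ constSpan L, (∀ X ∈ constSpan L, p ⁅X, Y⁆) → p Y) :
    ∀ Y ∈ constSpan L, p Y := by
  obtain ⟨N, hN⟩ := exists_spanLowerCentralSeries_eq_bot hnil
  have key : ∀ n, n ≤ N → ∀ Y ∈ spanLowerCentralSeries L n, p Y := by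
    intro n hn
    induction hn using Nat.decreasingInduction with
    | self =>
      intro Y hY
      rw [hN, Submodule.mem_bot] at hY
      rwa [hY]
    | of_succ n _ ih =>
      exact fun Y hY => hstep Y (spanLowerCentralSeries_le n hY) fun X hX =>
        ih _ (lie_mem_spanLowerCentralSeries_succ hX hY)
  rw [← spanLowerCentralSeries_zero]
  exact key 0 N.zero_le

/-- If `FL` is not contained in `V`, then it has an element outside `V` that is central
modulo `V`. -/
theorem exists_notMem_lie_mem (hnil : LieRing.IsNilpotent L)
    (V : Set (Derivation K R R)) (h0 : (0 : Derivation K R R) ∈ V)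
    (hV : ¬ (constSpan L : Set (Derivation K R R)) ⊆ V) :
    ∃ D ∈ constSpan L, D ∉ V ∧ ∀ X ∈ constSpan L, ⁅X, D⁆ ∈ V := by
  by_contra! hcon
  refine hV (constSpan_induction hnil (p := (· ∈ V)) h0 fun Y hY hbr => ?_)
  by_contra hYV
  obtain ⟨X, hX, hXY⟩ := hcon Y hY hYV
  exact hXY (hbr X hX)

end Filtration

section Frame

variable {K R : Type*} [Field K] [Field R] [Algebra K R]

/-- A basis `D 0, …, D (k - 1)` of `RL` over `R` made of elements of `FL`, such that
`[FL, D j]` lies in the span of the earlier `D i`. It comes with an extension `coord` to all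
derivations of the coordinate map. -/
structure Frame (L : LieSubalgebra K (Derivation K R R)) (k : ℕ) where
  /-- the basis of `RL` -/
  D : Fin k → Derivation K R R
  /-- the coordinates -/
  coord : Derivation K R R →ₗ[R] (Fin k → R)
  mem : ∀ j, D j ∈ constSpan L
  coord_D : ∀ j, coord (D j) = Pi.single j 1
  eq_sum : ∀ X ∈ constSpan L, X = ∑ i, coord X i • D i
  coord_lie_D : ∀ X ∈ constSpan L, ∀ i j, j ≤ i → coord ⁅X, D j⁆ i = 0

theorem constSpan_le_fieldSpan (L : LieSubalgebra K (Derivation K R R))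
    {X : Derivation K R R} (hX : X ∈ constSpan L) : X ∈ fieldSpan L := by
  unfold constSpan at hX
  induction hX using Submodule.span_induction with
  | mem X hX => exact Submodule.subset_span hX
  | zero => exact Submodule.zero_mem _
  | add u v _ _ hu hv => exact Submodule.add_mem _ hu hv
  | smul b X _ ih => exact Submodule.smul_mem _ (b : R) ih

/-- A flag is built by adding, as long as its span is not all of `RL`, an element of `FL` that is
central modulo this span. -/
theorem exists_linearIndependent_flag {L : LieSubalgebra K (Derivation K R R)}
    (hnil : LieRing.IsNilpotent L) {k : ℕ} (hrk : rk L = (k : Cardinal)) :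
    ∀ n ≤ k, ∃ D : Fin n → Derivation K R R, LinearIndependent R D ∧ (∀ j, D j ∈ constSpan L) ∧
      ∀ X ∈ constSpan L, ∀ j, ⁅X, D j⁆ ∈ Submodule.span R (D '' Set.Iio j) := by
  intro n hn
  induction n with
  | zero => exact ⟨Fin.elim0, linearIndependent_empty_type, fun j => j.elim0, fun _ _ j => j.elim0⟩
  | succ n ih =>
    obtain ⟨D, hli, hmem, hflag⟩ := ih (by omega)
    have hnot : ¬ (constSpan L : Set (Derivation K R R)) ⊆
        Submodule.span R (Set.range D) := by
      intro hsub
      have hle : fieldSpan L ≤ Submodule.span R (Set.range D) :=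
        Submodule.span_le.mpr fun X hX => hsub (mem_constSpan_of_mem hX)
      have h1 : rk L ≤ (n : Cardinal) := by
        refine (Submodule.rank_mono hle).trans ((rank_span_le _).trans ?_)
        simpa using Cardinal.mk_range_le_lift (f := D)
      rw [hrk, Nat.cast_le] at h1
      omega
    obtain ⟨E, hE, hEV, hEbr⟩ := exists_notMem_lie_mem hnil
      (Submodule.span R (Set.range D) : Set (Derivation K R R)) (Submodule.zero_mem _) hnot
    refine ⟨Fin.snoc D E, linearIndependent_finSnoc.mpr ⟨hli, hEV⟩, fun j => ?_, fun X hX j => ?_⟩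
    · refine Fin.lastCases ?_ (fun j => ?_) j
      · simpa using hE
      · simpa using hmem j
    · refine Fin.lastCases ?_ (fun j => ?_) j
      · have : (Fin.snoc D E : Fin (n + 1) → _) '' Set.Iio (Fin.last n) = Set.range D := by
          ext Y
          constructor
          · rintro ⟨i, hi, rfl⟩
            obtain ⟨i, rfl⟩ := Fin.exists_castSucc_eq.mpr (ne_of_lt hi)
            exact ⟨i, by simp⟩
          · rintro ⟨i, rfl⟩
            exact ⟨i.castSucc, Fin.castSucc_lt_last i, by simp⟩
        rw [this]
        simpa using hEbr X hX
      · have hsub : D '' Set.Iio j ⊆ (Fin.snoc D E : Fin (n + 1) → _) '' Set.Iio j.castSucc := by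
          rintro _ ⟨i, hi, rfl⟩
          exact ⟨i.castSucc, by simpa using hi, by simp⟩
        simpa using Submodule.span_mono hsub (hflag X hX j)

theorem exists_frame {L : LieSubalgebra K (Derivation K R R)}
    (hnil : LieRing.IsNilpotent L) {k : ℕ} (hrk : rk L = (k : Cardinal)) :
    Nonempty (Frame L k) := by
  obtain ⟨D, hli, hmem, hflag⟩ := exists_linearIndependent_flag hnil hrk k le_rfl
  obtain ⟨ψ, hψ⟩ := LinearMap.exists_extend (Module.Basis.span hli).equivFun.toLinearMap
  have hψD (j : Fin k) : ψ (D j) = Pi.single j 1 := by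
    have h1 := congrArg (fun f => f (Module.Basis.span hli j)) hψ
    have h2 : ((Module.Basis.span hli j : Submodule.span R (Set.range D)) :
        Derivation K R R) = D j :=
      congrArg Subtype.val (Module.Basis.span_apply hli j)
    simp only [LinearMap.comp_apply, Submodule.subtype_apply, h2] at h1
    rw [h1]
    ext i
    simp [Finsupp.single_apply, Pi.single_apply, eq_comm]
  have hfin : Module.Finite R (fieldSpan L) :=
    Module.rank_lt_aleph0_iff.mp (by
      change rk L < _
      rw [hrk]; exact Cardinal.natCast_lt_aleph0)
  have hspan : Submodule.span R (Set.range D) = fieldSpan L := by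
    refine Submodule.eq_of_le_of_finrank_eq (Submodule.span_le.mpr ?_) ?_
    · rintro _ ⟨j, rfl⟩
      exact constSpan_le_fieldSpan L (hmem j)
    · rw [finrank_span_eq_card hli, Fintype.card_fin]
      exact (Module.finrank_eq_of_rank_eq hrk).symm
  refine ⟨⟨D, ψ, hmem, hψD, fun X hX => ?_, fun X hX i j hij => ?_⟩⟩
  · have hX' := constSpan_le_fieldSpan L hX
    rw [← hspan] at hX'
    clear hX
    induction hX' using Submodule.span_induction with
    | mem X hX =>
      obtain ⟨j, rfl⟩ := hX
      simp [hψD, Pi.single_apply]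
    | zero => simp
    | add u v _ _ hu hv =>
      simp only [map_add, Pi.add_apply, add_smul, Finset.sum_add_distrib]
      rw [← hu, ← hv]
    | smul b X _ ih =>
      simp only [map_smul, Pi.smul_apply, smul_eq_mul, mul_smul, ← Finset.smul_sum]
      rw [← ih]
  · have hbr := hflag X hX j
    generalize ⁅X, D j⁆ = Y at hbr
    induction hbr using Submodule.span_induction with
    | mem X hX =>
      obtain ⟨l, hl, rfl⟩ := hX
      simp [hψD, (hl.trans_le hij).ne']
    | zero => simp
    | add u v _ _ hu hv => simp [hu, hv]
    | smul b X _ ih => simp [ih]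

end Frame

end FractionFieldDerivations

/-! ### Coordinates in a flag, and finite dimension -/

namespace FractionFieldDerivations

variable {K R : Type*} [Field K] [Field R] [Algebra K R]
  {L : LieSubalgebra K (Derivation K R R)}

/-- The elements of `FL` are `F`-linear derivations. -/
def toConstDerivation (X : constSpan L) : Derivation (constants L) R R :=
  Derivation.mk'
    { toFun := (X : Derivation K R R)
      map_add' := map_add _
      map_smul' := fun a f => by
        change (X : Derivation K R R) ((a : R) * f) = (a : R) * (X : Derivation K R R) f
        simp [constSpan_apply_const L X.2 a] }
    fun f g => (X : Derivation K R R).leibniz f g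

namespace Frame

variable {k : ℕ} (fr : Frame L k)

/-- The `i`-th coordinate as an `F`-linear map. -/
def coordConst (i : Fin k) : Derivation K R R →ₗ[constants L] R :=
  ((LinearMap.proj i).comp fr.coord).restrictScalars (constants L)

theorem coordConst_apply (i : Fin k) (X : Derivation K R R) :
    fr.coordConst i X = fr.coord X i := rfl

theorem coord_D_apply (j i : Fin k) : fr.coord (fr.D j) i = if i = j then 1 else 0 := by
  rw [fr.coord_D, Pi.single_apply]

theorem apply_eq_sum {X : Derivation K R R} (hX : X ∈ constSpan L) (f : R) :
    X f = ∑ i, fr.coord X i * fr.D i f := by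
  conv_lhs => rw [fr.eq_sum X hX]
  rw [← Derivation.coeFnAddMonoidHom_apply, map_sum, Finset.sum_apply]
  simp [Derivation.coeFnAddMonoidHom_apply]

theorem eq_zero {X : Derivation K R R} (hX : X ∈ constSpan L) (h : ∀ i, fr.coord X i = 0) :
    X = 0 := by
  rw [fr.eq_sum X hX]
  simp [h]

theorem mem_constants {f : R} (h : ∀ i, fr.D i f = 0) : f ∈ constants L := fun X hX => by
  rw [fr.apply_eq_sum (mem_constSpan_of_mem hX)]
  simp [h]

/-- Coordinates of `[X, ∑ y_l D_l] = ∑ (X(y_l) D_l + y_l [X, D_l])`. -/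
theorem coord_lie (X : Derivation K R R) {Y : Derivation K R R} (hY : Y ∈ constSpan L)
    (i : Fin k) : fr.coord ⁅X, Y⁆ i =
      X (fr.coord Y i) + ∑ l, fr.coord Y l * fr.coord ⁅X, fr.D l⁆ i := by
  have h : ⁅X, Y⁆ = ∑ l, (X (fr.coord Y l) • fr.D l + fr.coord Y l • ⁅X, fr.D l⁆) := by
    conv_lhs => rw [fr.eq_sum Y hY]
    rw [lie_sum]
    refine Finset.sum_congr rfl fun l _ => ?_
    ext f
    simp only [Derivation.commutator_apply, Derivation.add_apply, Derivation.smul_apply,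
      Derivation.leibniz, smul_eq_mul]
    ring
  rw [h]
  simp [Finset.sum_add_distrib, fr.coord_D_apply]

theorem coord_D_lie {Y : Derivation K R R} (hY : Y ∈ constSpan L) {i j : Fin k} (hij : j ≤ i) :
    fr.coord ⁅fr.D j, Y⁆ i = 0 := by
  rw [← lie_skew, map_neg, Pi.neg_apply, fr.coord_lie_D Y hY i j hij, neg_zero]

theorem coord_lie_eq_sum {X Y : Derivation K R R} (hX : X ∈ constSpan L) (hY : Y ∈ constSpan L)
    (i : Fin k) : fr.coord ⁅X, Y⁆ i = X (fr.coord Y i) - Y (fr.coord X i) +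
      ∑ l, ∑ m, fr.coord Y l * fr.coord X m * fr.coord ⁅fr.D m, fr.D l⁆ i := by
  have h (l : Fin k) : fr.coord ⁅X, fr.D l⁆ i = -(fr.D l (fr.coord X i) +
      ∑ m, fr.coord X m * fr.coord ⁅fr.D l, fr.D m⁆ i) := by
    rw [← lie_skew, map_neg, Pi.neg_apply, fr.coord_lie _ hX]
  rw [fr.coord_lie X hY, fr.apply_eq_sum hY (fr.coord X i), sub_add, ← Finset.sum_sub_distrib,
    ← sub_neg_eq_add, ← Finset.sum_neg_distrib]
  congr 1
  refine Finset.sum_congr rfl fun l _ => ?_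
  rw [h, mul_neg, neg_neg, mul_add, Finset.mul_sum, sub_eq_add_neg, ← Finset.sum_neg_distrib]
  congr 1
  refine Finset.sum_congr rfl fun m _ => ?_
  rw [← lie_skew (fr.D l), map_neg, Pi.neg_apply]
  ring

/-- The first element of a frame is central in `FL`. -/
theorem lie_D_zero {k : ℕ} (fr : Frame L (k + 1)) {X : Derivation K R R}
    (hX : X ∈ constSpan L) : ⁅X, fr.D 0⁆ = 0 :=
  fr.eq_zero (constSpan_lie_mem L hX (fr.mem 0)) fun i => fr.coord_lie_D X hX i 0 i.zero_le

/-- The centralizer of the frame in `FL`, cut down to the span of the first `n` frame elements. -/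
def centralizerFlag (n : ℕ) : Submodule (constants L) (Derivation K R R) where
  carrier := {Y | Y ∈ constSpan L ∧ (∀ j, ⁅fr.D j, Y⁆ = 0) ∧ ∀ l : Fin k, n ≤ l → fr.coord Y l = 0}
  add_mem' := fun ⟨h1, h2, h3⟩ ⟨h1', h2', h3'⟩ => ⟨Submodule.add_mem _ h1 h1',
    fun j => by rw [lie_add, h2, h2', add_zero], fun l hl => by simp [h3 l hl, h3' l hl]⟩
  zero_mem' := ⟨Submodule.zero_mem _, fun j => lie_zero _, fun l _ => by simp⟩
  smul_mem' := fun a Y ⟨h1, h2, h3⟩ => ⟨Submodule.smul_mem _ _ h1,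
    fun j => by rw [lie_const_smul L (fr.mem j), h2, smul_zero],
    fun l hl => by
      rw [← coordConst_apply, map_smul, coordConst_apply, h3 l hl, smul_zero]⟩

/-- The leading coordinate of an element that commutes with the frame is a constant. -/
theorem coord_mem_constants {n : Fin k} {Y : Derivation K R R}
    (hY : Y ∈ fr.centralizerFlag (n + 1)) : fr.coord Y n ∈ constants L := by
  obtain ⟨hmem, hcent, hlead⟩ := hY
  refine fr.mem_constants fun j => ?_
  have h := fr.coord_lie (fr.D j) hmem n
  rw [hcent, Finset.sum_eq_zero, add_zero] at h
  · simpa using h.symm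
  · intro l _
    rcases le_or_gt l n with hln | hln
    · rw [fr.coord_lie_D _ (fr.mem j) n l hln, mul_zero]
    · rw [hlead l (Nat.succ_le_of_lt hln), zero_mul]

theorem centralizerFlag_fg (n : ℕ) (hn : n ≤ k) : (fr.centralizerFlag n).FG := by
  induction n with
  | zero =>
    have : fr.centralizerFlag 0 = ⊥ := (Submodule.eq_bot_iff _).mpr fun Y hY =>
      fr.eq_zero hY.1 fun i => hY.2.2 i (Nat.zero_le _)
    rw [this]
    exact Submodule.fg_bot
  | succ n ih =>
    refine Submodule.fg_of_fg_map_of_fg_inf_ker (fr.coordConst ⟨n, hn⟩) ?_ ?_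
    · refine Submodule.FG.of_le (Submodule.fg_span_singleton (1 : R)) ?_
      rintro _ ⟨Y, hY, rfl⟩
      have hc := fr.coord_mem_constants (n := ⟨n, hn⟩) hY
      refine Submodule.mem_span_singleton.mpr ⟨⟨_, hc⟩, ?_⟩
      exact mul_one _
    · refine Submodule.FG.of_le (ih (by omega)) ?_
      rintro Y ⟨hY, hY0⟩
      refine ⟨hY.1, hY.2.1, fun l hl => ?_⟩
      rcases hl.eq_or_lt with hl | hl
      · obtain rfl : ⟨n, hn⟩ = l := Fin.ext hl
        exact hY0
      · exact hY.2.2 l hl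

include fr in
/-- `FL` is finite-dimensional: bracketing with the frame maps each term of the lower central
series to the next one, with finite-dimensional kernel. -/
theorem finiteDimensional (hnil : LieRing.IsNilpotent L) :
    FiniteDimensional (constants L) (constSpan L) := by
  obtain ⟨N, hN⟩ := exists_spanLowerCentralSeries_eq_bot hnil
  let φ : Derivation K R R →ₗ[constants L] (Fin k → Derivation K R R) :=
    { toFun := fun Y j => ⁅fr.D j, Y⁆
      map_add' := fun Y Z => funext fun j => lie_add _ _ _
      map_smul' := fun a Y => funext fun j => lie_const_smul L (fr.mem j) a Y }
  have key : ∀ n, n ≤ N → (spanLowerCentralSeries L n).FG := by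
    intro n hn
    induction hn using Nat.decreasingInduction with
    | self => rw [hN]; exact Submodule.fg_bot
    | of_succ n _ ih =>
      refine Submodule.fg_of_fg_map_of_fg_inf_ker φ ?_ ?_
      · refine Submodule.FG.of_le (Submodule.fg_pi fun _ : Fin k => ih) ?_
        rintro _ ⟨Y, hY, rfl⟩ j _
        exact lie_mem_spanLowerCentralSeries_succ (fr.mem j) hY
      · refine Submodule.FG.of_le (fr.centralizerFlag_fg k le_rfl) ?_
        rintro Y ⟨hY, hY0⟩
        exact ⟨spanLowerCentralSeries_le n hY, fun j => congrFun hY0 j,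
          fun l hl => absurd l.isLt (not_lt.mpr hl)⟩
  rw [← spanLowerCentralSeries_zero]
  exact Module.Finite.iff_fg.mpr (key 0 N.zero_le)

end Frame

end FractionFieldDerivations

/-! ### Embeddings into `u_2` and `u_3` from coordinates -/

namespace FractionFieldDerivations

open MvPolynomial LocallyNilpotent

theorem mkDerivation_apply_eq_sum {F : Type*} [Field F] {n : ℕ}
    (p : Fin n → MvPolynomial (Fin n) F) (q : MvPolynomial (Fin n) F) :
    mkDerivation F p q = ∑ i, p i * pderiv i q := by
  have h : mkDerivation F p = ∑ i, p i • pderiv i := derivation_ext fun j => by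
    rw [mkDerivation_X, ← Derivation.coeFnAddMonoidHom_apply, map_sum, Finset.sum_apply]
    simp [Derivation.coeFnAddMonoidHom_apply, pderiv_X, Pi.single_apply]
  rw [h, ← Derivation.coeFnAddMonoidHom_apply, map_sum, Finset.sum_apply]
  simp [Derivation.coeFnAddMonoidHom_apply]

/-- The data of the rank three case give an embedding into `u_3(F)`. The elements of `g` are
written as `s D 0 + r D 1 + e D 2` with coefficients in `B`, where `[D 2, D 1] = c D 0`; then
`D 0`, `D 1`, `D 2` are sent to `∂₀`, `∂₁ + H ∂₀`, `∂₂` with `∂₂ H = c`. -/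
theorem exists_lieSubalgebra_triangular_three {F g B : Type*} [Field F] [CharZero F] [LieRing g]
    [LieAlgebra F g] [FiniteDimensional F g] [CommRing B] [Algebra F B]
    {D₁ D₂ : Derivation F B B} {τ : B →ₐ[F] MvPolynomial (Fin 3) F}
    (hτ : ∀ (d : Derivation F (MvPolynomial (Fin 3) F) (MvPolynomial (Fin 3) F)) f,
      d (τ f) = d (X 1) * τ (D₁ f) + d (X 2) * τ (D₂ f))
    (hS : ∀ S : Subalgebra F (MvPolynomial (Fin 3) F), X 1 ∈ S → X 2 ∈ S → ∀ f, τ f ∈ S)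
    (hS' : ∀ S : Subalgebra F (MvPolynomial (Fin 3) F), X 2 ∈ S → ∀ f, D₁ f = 0 → τ f ∈ S)
    (hinj : (∀ f, τ f = 0 → τ (D₁ f) = 0) → (∀ f, τ f = 0 → τ (D₂ f) = 0) → Function.Injective τ)
    (s r e : g →ₗ[F] B) (c : B) (D₁r : ∀ Y, D₁ (r Y) = 0)
    (he : ∀ Y, ∃ a : F, algebraMap F B a = e Y)
    (lie_e : ∀ Y Z : g, e ⁅Y, Z⁆ = 0)
    (lie_r : ∀ Y Z : g, r ⁅Y, Z⁆ = e Y * D₂ (r Z) - e Z * D₂ (r Y))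
    (lie_s : ∀ Y Z : g, s ⁅Y, Z⁆ = r Y * D₁ (s Z) + e Y * D₂ (s Z) -
      (r Z * D₁ (s Y) + e Z * D₂ (s Y)) + (e Y * r Z - e Z * r Y) * c)
    (hg : ∀ Y, s Y = 0 → r Y = 0 → e Y = 0 → Y = 0) :
    ∃ S : LieSubalgebra F (triangular F 3), FiniteDimensional F S ∧ Nonempty (g ≃ₗ⁅F⁆ S) := by
  have τ_inj : Function.Injective τ := by
    refine hinj (fun f hf => ?_) (fun f hf => ?_)
    · simpa [hf, pderiv_X] using (hτ (pderiv 1) f).symm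
    · simpa [hf, pderiv_X] using (hτ (pderiv 2) f).symm
  have hX (s : Set (Fin 3)) (i : Fin 3) (hi : i ∈ s) :
      (X i : MvPolynomial (Fin 3) F) ∈ supported F s := X_mem_supported.mpr hi
  have τ_supp (f : B) : τ f ∈ supported F {j : Fin 3 | 0 < j} :=
    hS _ (hX _ 1 (by decide)) (hX _ 2 (by decide)) f
  obtain ⟨H, hH, hHc⟩ := exists_pderiv_eq_of_mem_supported (i := (2 : Fin 3)) (by decide)
    (τ_supp c)
  have hH0 : pderiv 0 H = 0 := pderiv_eq_zero_of_notMem_vars fun h0 =>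
    absurd (mem_supported.mp hH h0) (by decide)
  let P : g →ₗ[F] (Fin 3 → MvPolynomial (Fin 3) F) :=
    LinearMap.pi ![τ.toLinearMap.comp s + (LinearMap.mulLeft F H).comp (τ.toLinearMap.comp r),
      τ.toLinearMap.comp r, τ.toLinearMap.comp e]
  have P0 (Y) : P Y 0 = τ (s Y) + H * τ (r Y) := rfl
  have P1 (Y) : P Y 1 = τ (r Y) := rfl
  have P2 (Y) : P Y 2 = τ (e Y) := rfl
  have De (Y) (D : Derivation F B B) : D (e Y) = 0 := by
    obtain ⟨a, ha⟩ := he Y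
    rw [← ha, Derivation.map_algebraMap]
  have hd (Y f) : mkDerivation F (P Y) (τ f) = τ (r Y) * τ (D₁ f) + τ (e Y) * τ (D₂ f) := by
    rw [hτ, mkDerivation_X, mkDerivation_X, P1, P2]
  have hdH (Y) : mkDerivation F (P Y) H = τ (r Y) * pderiv 1 H + τ (e Y) * τ c := by
    rw [mkDerivation_apply_eq_sum, Fin.sum_univ_three, hH0, hHc, P1, P2, mul_zero, zero_add]
  refine exists_lieSubalgebra_triangular P (fun Y i => ?_) (fun Y Z i => ?_) fun Y hY => ?_
  · fin_cases i
    · exact Subalgebra.add_mem _ (τ_supp _) (Subalgebra.mul_mem _ hH (τ_supp _))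
    · exact hS' _ (hX _ 2 (by decide)) _ (D₁r Y)
    · obtain ⟨a, ha⟩ := he Y
      change τ (e Y) ∈ _
      rw [← ha, τ.commutes]
      exact Subalgebra.algebraMap_mem _ _
  · fin_cases i
    · change P ⁅Y, Z⁆ 0 = mkDerivation F (P Y) (P Z 0) - mkDerivation F (P Z) (P Y 0)
      simp only [P0, map_add, Derivation.leibniz, hd, hdH, lie_s, lie_r, D₁r, map_sub, map_mul,
        map_zero, smul_eq_mul]
      ring
    · change P ⁅Y, Z⁆ 1 = mkDerivation F (P Y) (P Z 1) - mkDerivation F (P Z) (P Y 1)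
      simp only [P1, hd, lie_r, D₁r, map_sub, map_mul, map_zero]
      ring
    · change P ⁅Y, Z⁆ 2 = mkDerivation F (P Y) (P Z 2) - mkDerivation F (P Z) (P Y 2)
      simp only [P2, hd, lie_e, De, map_zero]
      ring
  · have hz (f : B) (hf : τ f = 0) : f = 0 := τ_inj (hf.trans (map_zero τ).symm)
    have hr : τ (r Y) = 0 := congrFun hY 1
    have hs : τ (s Y) = 0 := by
      have h := congrFun hY 0
      rwa [P0, hr, mul_zero, add_zero] at h
    exact hg Y (hz _ hs) (hz _ hr) (hz _ (congrFun hY 2))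

/-- The data of the rank two case give an embedding into `u_2(F)`. -/
theorem exists_lieSubalgebra_triangular_two {F g B : Type*} [Field F] [LieRing g]
    [LieAlgebra F g] [FiniteDimensional F g] [CommRing B] [Algebra F B]
    {D₂ : Derivation F B B} {τ : B →ₐ[F] MvPolynomial (Fin 2) F}
    (hτ : ∀ (d : Derivation F (MvPolynomial (Fin 2) F) (MvPolynomial (Fin 2) F)) f,
      d (τ f) = d (X 1) * τ (D₂ f))
    (hS : ∀ S : Subalgebra F (MvPolynomial (Fin 2) F), X 1 ∈ S → ∀ f, τ f ∈ S)
    (hinj : (∀ f, τ f = 0 → τ (D₂ f) = 0) → Function.Injective τ)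
    (s e : g →ₗ[F] B) (he : ∀ Y, ∃ a : F, algebraMap F B a = e Y)
    (lie_e : ∀ Y Z : g, e ⁅Y, Z⁆ = 0)
    (lie_s : ∀ Y Z : g, s ⁅Y, Z⁆ = e Y * D₂ (s Z) - e Z * D₂ (s Y))
    (hg : ∀ Y, s Y = 0 → e Y = 0 → Y = 0) :
    ∃ S : LieSubalgebra F (triangular F 2), FiniteDimensional F S ∧ Nonempty (g ≃ₗ⁅F⁆ S) := by
  have τ_inj : Function.Injective τ := hinj fun f hf => by
    simpa [hf, pderiv_X] using (hτ (pderiv 1) f).symm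
  let P : g →ₗ[F] (Fin 2 → MvPolynomial (Fin 2) F) :=
    LinearMap.pi ![τ.toLinearMap.comp s, τ.toLinearMap.comp e]
  have P0 (Y) : P Y 0 = τ (s Y) := rfl
  have P1 (Y) : P Y 1 = τ (e Y) := rfl
  have De (Y) : D₂ (e Y) = 0 := by
    obtain ⟨a, ha⟩ := he Y
    rw [← ha, Derivation.map_algebraMap]
  have hd (Y f) : mkDerivation F (P Y) (τ f) = τ (e Y) * τ (D₂ f) := by
    rw [hτ, mkDerivation_X, P1]
  refine exists_lieSubalgebra_triangular P (fun Y i => ?_) (fun Y Z i => ?_) fun Y hY => ?_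
  · fin_cases i
    · exact hS _ (X_mem_supported.mpr (by decide)) _
    · obtain ⟨a, ha⟩ := he Y
      change τ (e Y) ∈ _
      rw [← ha, τ.commutes]
      exact Subalgebra.algebraMap_mem _ _
  · fin_cases i
    · change P ⁅Y, Z⁆ 0 = mkDerivation F (P Y) (P Z 0) - mkDerivation F (P Z) (P Y 0)
      simp only [P0, hd, lie_s, map_sub, map_mul]
    · change P ⁅Y, Z⁆ 1 = mkDerivation F (P Y) (P Z 1) - mkDerivation F (P Z) (P Y 1)
      simp only [P1, hd, lie_e, De, map_zero]
      ring
  · have hz (f : B) (hf : τ f = 0) : f = 0 := τ_inj (hf.trans (map_zero τ).symm)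
    exact hg Y (hz _ (congrFun hY 0)) (hz _ (congrFun hY 1))

/-! ### Rank three -/

namespace Frame

variable {K R : Type*} [Field K] [CharZero K] [Field R] [Algebra K R]
  {L : LieSubalgebra K (Derivation K R R)}

/-- A frame element as an `F`-linear derivation. -/
def DF {k : ℕ} (fr : Frame L k) (i : Fin k) : Derivation (constants L) R R :=
  toConstDerivation ⟨fr.D i, fr.mem i⟩

omit [CharZero K] in
theorem DF_apply {k : ℕ} (fr : Frame L k) (i : Fin k) (f : R) : fr.DF i f = fr.D i f := rfl

omit [CharZero K] in
theorem lie_zero_D {k : ℕ} (fr : Frame L (k + 1)) {X : Derivation K R R}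
    (hX : X ∈ constSpan L) : ⁅fr.D 0, X⁆ = 0 := by
  rw [← lie_skew, fr.lie_D_zero hX, neg_zero]

omit [CharZero K] in
theorem D_zero_D_eq_zero {k : ℕ} (fr : Frame L (k + 1)) {f : R} (hf : fr.D 0 f = 0)
    (i : Fin (k + 1)) : fr.D 0 (fr.D i f) = 0 := by
  have h := congrArg (fun D => D f) (fr.lie_D_zero (fr.mem i))
  simpa only [Derivation.commutator_apply, hf, map_zero, zero_sub, Derivation.zero_apply,
    neg_eq_zero] using h

/-- The `i`-th coordinate on `FL`, with values in a subalgebra that contains them. -/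
def coordAlg {k : ℕ} (fr : Frame L k) (i : Fin k) (B : Subalgebra (constants L) R)
    (h : ∀ Y ∈ constSpan L, fr.coord Y i ∈ B) : constSpan L →ₗ[constants L] B :=
  ((fr.coordConst i).comp (constSpan L).subtype).codRestrict B.toSubmodule fun Y => h Y Y.2

section Three

variable (fr : Frame L 3)

/-- The structure constant of a frame of length three: `[D 2, D 1] = c D 0`. -/
def heisenbergCoeff : R := fr.coord ⁅fr.D 2, fr.D 1⁆ 0

omit [CharZero K]

theorem lie_D_two_one : ⁅fr.D 2, fr.D 1⁆ = fr.heisenbergCoeff • fr.D 0 := by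
  rw [fr.eq_sum _ (constSpan_lie_mem L (fr.mem 2) (fr.mem 1)), Fin.sum_univ_three,
    fr.coord_lie_D _ (fr.mem 2) 1 1 le_rfl, fr.coord_lie_D _ (fr.mem 2) 2 1 (by decide)]
  simp [heisenbergCoeff]

theorem lie_D_one_two : ⁅fr.D 1, fr.D 2⁆ = -(fr.heisenbergCoeff • fr.D 0) := by
  rw [← lie_skew, lie_D_two_one]

theorem D_coord_two {Y : Derivation K R R} (hY : Y ∈ constSpan L) (j : Fin 3) :
    fr.D j (fr.coord Y 2) = 0 := by
  have h := fr.coord_lie (fr.D j) hY 2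
  rw [fr.coord_D_lie hY (show j ≤ 2 from Fin.le_last j)] at h
  fin_cases j <;> simpa [Fin.sum_univ_three, fr.lie_D_zero (fr.mem _), fr.lie_zero_D (fr.mem _),
    lie_D_two_one, lie_D_one_two, fr.coord_D_apply] using h.symm

theorem D_coord_one {Y : Derivation K R R} (hY : Y ∈ constSpan L) (j : Fin 3) :
    fr.D j (fr.coord Y 1) = fr.coord ⁅fr.D j, Y⁆ 1 := by
  rw [fr.coord_lie (fr.D j) hY 1]
  fin_cases j <;> simp [Fin.sum_univ_three, fr.lie_D_zero (fr.mem _), fr.lie_zero_D (fr.mem _),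
    lie_D_two_one, lie_D_one_two, fr.coord_D_apply]

theorem D_zero_coord_zero {Y : Derivation K R R} (hY : Y ∈ constSpan L) :
    fr.D 0 (fr.coord Y 0) = 0 := by
  have h := fr.coord_lie (fr.D 0) hY 0
  rw [fr.coord_D_lie hY le_rfl] at h
  simpa [fr.lie_zero_D (fr.mem _)] using h.symm

theorem D_one_coord_zero {Y : Derivation K R R} (hY : Y ∈ constSpan L) :
    fr.D 1 (fr.coord Y 0) = fr.coord ⁅fr.D 1, Y⁆ 0 + fr.coord Y 2 * fr.heisenbergCoeff := by
  rw [fr.coord_lie (fr.D 1) hY 0]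
  simp [Fin.sum_univ_three, fr.lie_D_zero (fr.mem _), lie_D_one_two, fr.coord_D_apply]

theorem D_two_coord_zero {Y : Derivation K R R} (hY : Y ∈ constSpan L) :
    fr.D 2 (fr.coord Y 0) = fr.coord ⁅fr.D 2, Y⁆ 0 - fr.coord Y 1 * fr.heisenbergCoeff := by
  rw [fr.coord_lie (fr.D 2) hY 0]
  simp [Fin.sum_univ_three, fr.lie_D_zero (fr.mem _), lie_D_two_one, fr.coord_D_apply]

variable {Y Z : Derivation K R R} (hY : Y ∈ constSpan L) (hZ : Z ∈ constSpan L)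
include hY hZ

theorem coord_two_lie : fr.coord ⁅Y, Z⁆ 2 = 0 := by
  rw [fr.coord_lie_eq_sum hY hZ, fr.apply_eq_sum hY, fr.apply_eq_sum hZ]
  simp [Fin.sum_univ_three, fr.lie_D_zero (fr.mem _), fr.lie_zero_D (fr.mem _), lie_D_two_one,
    lie_D_one_two, fr.coord_D_apply, fr.D_coord_two hY, fr.D_coord_two hZ]

theorem coord_one_lie : fr.coord ⁅Y, Z⁆ 1 =
    fr.coord Y 2 * fr.D 2 (fr.coord Z 1) - fr.coord Z 2 * fr.D 2 (fr.coord Y 1) := by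
  have hz {Y : Derivation K R R} (hY : Y ∈ constSpan L) (j : Fin 3) (hj : j ≤ 1) :
      fr.D j (fr.coord Y 1) = 0 := (fr.D_coord_one hY j).trans (fr.coord_D_lie hY hj)
  rw [fr.coord_lie_eq_sum hY hZ, fr.apply_eq_sum hY, fr.apply_eq_sum hZ]
  simp [Fin.sum_univ_three, fr.lie_D_zero (fr.mem _), fr.lie_zero_D (fr.mem _), lie_D_two_one,
    lie_D_one_two, fr.coord_D_apply, hz hY, hz hZ]

theorem coord_zero_lie : fr.coord ⁅Y, Z⁆ 0 =
    fr.coord Y 1 * fr.D 1 (fr.coord Z 0) + fr.coord Y 2 * fr.D 2 (fr.coord Z 0) -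
    (fr.coord Z 1 * fr.D 1 (fr.coord Y 0) + fr.coord Z 2 * fr.D 2 (fr.coord Y 0)) +
    (fr.coord Y 2 * fr.coord Z 1 - fr.coord Z 2 * fr.coord Y 1) * fr.heisenbergCoeff := by
  rw [fr.coord_lie_eq_sum hY hZ, fr.apply_eq_sum hY, fr.apply_eq_sum hZ]
  simp [Fin.sum_univ_three, fr.lie_D_zero (fr.mem _), fr.lie_zero_D (fr.mem _), lie_D_two_one,
    lie_D_one_two, fr.coord_D_apply, fr.D_zero_coord_zero hY, fr.D_zero_coord_zero hZ]
  ring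

end Three

section ThreeNil

omit [CharZero K]

variable (fr : Frame L 3) (hnil : LieRing.IsNilpotent L)

theorem coord_two_mem_nilSubalgebra {Y : Derivation K R R} (hY : Y ∈ constSpan L) :
    fr.coord Y 2 ∈ nilSubalgebra (fr.DF 0) (fr.DF 1) (fr.DF 2) :=
  Subalgebra.algebraMap_mem _ (⟨_, fr.mem_constants (fr.D_coord_two hY)⟩ : constants L)

include hnil

theorem coord_one_mem_nilSubalgebra : ∀ Y ∈ constSpan L,
    fr.coord Y 1 ∈ nilSubalgebra (fr.DF 0) (fr.DF 1) (fr.DF 2) := by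
  refine constSpan_induction hnil (by simp) fun Y hY ih => ?_
  refine mem_nilSubalgebra_of_apply_mem ?_ ?_ ?_
  · rw [DF_apply, fr.D_coord_one hY, fr.coord_D_lie hY (by decide)]
  · rw [DF_apply, fr.D_coord_one hY]; exact ih _ (fr.mem 1)
  · rw [DF_apply, fr.D_coord_one hY]; exact ih _ (fr.mem 2)

theorem heisenbergCoeff_mem_nilSubalgebra :
    fr.heisenbergCoeff ∈ nilSubalgebra (fr.DF 0) (fr.DF 1) (fr.DF 2) := by
  -- more generally this holds for the coefficient of every element of `FL ∩ R D 0`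
  have key : ∀ Y ∈ constSpan L, fr.coord Y 1 = 0 → fr.coord Y 2 = 0 →
      fr.coord Y 0 ∈ nilSubalgebra (fr.DF 0) (fr.DF 1) (fr.DF 2) := by
    refine constSpan_induction hnil (by simp) fun Y hY ih hr he => ?_
    have hstep (j : Fin 3) :
        fr.coord ⁅fr.D j, Y⁆ 0 ∈ nilSubalgebra (fr.DF 0) (fr.DF 1) (fr.DF 2) :=
      ih _ (fr.mem j) (by rw [← fr.D_coord_one hY, hr, map_zero])
        (fr.coord_D_lie hY (show j ≤ 2 from Fin.le_last j))
    refine mem_nilSubalgebra_of_apply_mem (fr.D_zero_coord_zero hY) ?_ ?_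
    · rw [DF_apply, fr.D_one_coord_zero hY, he, zero_mul, add_zero]; exact hstep 1
    · rw [DF_apply, fr.D_two_coord_zero hY, hr, zero_mul, sub_zero]; exact hstep 2
  exact key _ (constSpan_lie_mem L (fr.mem 2) (fr.mem 1))
    (fr.coord_lie_D _ (fr.mem 2) 1 1 le_rfl) (fr.coord_lie_D _ (fr.mem 2) 2 1 (by decide))

/-- The coordinates of `[D 1, Y]` and `[D 2, Y]` differ from the derivatives of the coordinate of
`Y` by elements of the algebra, so membership climbs up the lower central series. -/
theorem coord_zero_mem_nilSubalgebra : ∀ Y ∈ constSpan L,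
    fr.coord Y 0 ∈ nilSubalgebra (fr.DF 0) (fr.DF 1) (fr.DF 2) := by
  have hc := fr.heisenbergCoeff_mem_nilSubalgebra hnil
  refine constSpan_induction hnil (by simp) fun Y hY ih => ?_
  refine mem_nilSubalgebra_of_apply_mem (fr.D_zero_coord_zero hY) ?_ ?_
  · rw [DF_apply, fr.D_one_coord_zero hY]
    exact Subalgebra.add_mem _ (ih _ (fr.mem 1))
      (Subalgebra.mul_mem _ (fr.coord_two_mem_nilSubalgebra hY) hc)
  · rw [DF_apply, fr.D_two_coord_zero hY]
    exact Subalgebra.sub_mem _ (ih _ (fr.mem 2))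
      (Subalgebra.mul_mem _ (fr.coord_one_mem_nilSubalgebra hnil Y hY) hc)

end ThreeNil

theorem embeds_three (fr : Frame L 3) (hnil : LieRing.IsNilpotent L) :
    ∃ S : LieSubalgebra (constants L) (triangular (constants L) 3),
      FiniteDimensional (constants L) S ∧ Nonempty (constSpan L ≃ₗ⁅constants L⁆ S) := by
  have : FiniteDimensional (constants L) (constSpan L) := fr.finiteDimensional hnil
  have : CharZero (constants L) := charZero_of_injective_algebraMap
    (algebraMap K (constants L)).injective
  have comm (i : Fin 3) (f : R) (hf : fr.DF 0 f = 0) : fr.DF 0 (fr.DF i f) = 0 :=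
    fr.D_zero_D_eq_zero hf i
  obtain ⟨D₁, D₂, τ, hD₁, hD₂, hτ, hS, hS', hinj⟩ := exists_taylor_nilSubalgebra
    (comm 1) (comm 2)
    (fun f hf => by
      have h := congrArg (fun D => D f) fr.lie_D_two_one
      rw [DF_apply] at hf
      simp only [Derivation.commutator_apply, Derivation.smul_apply, hf, smul_zero] at h
      exact (sub_eq_zero.mp h).symm)
    (fun f h0 h1 h2 => ⟨⟨f, fr.mem_constants fun i => by fin_cases i; exacts [h0, h1, h2]⟩, rfl⟩)
    (X 1 : MvPolynomial (Fin 3) (constants L)) (X 2)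
  refine exists_lieSubalgebra_triangular_three hτ hS hS' hinj
    (fr.coordAlg 0 _ (fr.coord_zero_mem_nilSubalgebra hnil))
    (fr.coordAlg 1 _ (fr.coord_one_mem_nilSubalgebra hnil))
    (fr.coordAlg 2 _ fun Y hY => fr.coord_two_mem_nilSubalgebra hY)
    ⟨_, fr.heisenbergCoeff_mem_nilSubalgebra hnil⟩
    (fun Y => Subtype.ext ((hD₁ _).trans
      ((fr.D_coord_one Y.2 1).trans (fr.coord_D_lie Y.2 le_rfl))))
    (fun Y => ⟨⟨_, fr.mem_constants (fr.D_coord_two Y.2)⟩, rfl⟩)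
    (fun Y Z => Subtype.ext (fr.coord_two_lie Y.2 Z.2))
    (fun Y Z => Subtype.ext ?_) (fun Y Z => Subtype.ext ?_) (fun Y hs hr he => ?_)
  · refine (fr.coord_one_lie Y.2 Z.2).trans ?_
    push_cast
    rw [hD₂, hD₂]
    rfl
  · refine (fr.coord_zero_lie Y.2 Z.2).trans ?_
    push_cast
    rw [hD₁, hD₁, hD₂, hD₂]
    rfl
  · refine Subtype.ext (fr.eq_zero Y.2 fun i => ?_)
    fin_cases i
    exacts [congrArg Subtype.val hs, congrArg Subtype.val hr, congrArg Subtype.val he]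

end Frame

end FractionFieldDerivations

/-! ### Rank at most two -/

namespace FractionFieldDerivations

open MvPolynomial LocallyNilpotent

namespace Frame

variable {K R : Type*} [Field K] [CharZero K] [Field R] [Algebra K R]
  {L : LieSubalgebra K (Derivation K R R)}

section Two

omit [CharZero K]

variable (fr : Frame L 2)

theorem lie_D_D_two (i j : Fin 2) : ⁅fr.D i, fr.D j⁆ = 0 := by
  fin_cases i <;> fin_cases j <;>
    simp [fr.lie_D_zero (fr.mem _), fr.lie_zero_D (fr.mem _)]

theorem coord_lie_two {Y Z : Derivation K R R} (hY : Y ∈ constSpan L) (hZ : Z ∈ constSpan L)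
    (i : Fin 2) : fr.coord ⁅Y, Z⁆ i = Y (fr.coord Z i) - Z (fr.coord Y i) := by
  simp [fr.coord_lie_eq_sum hY hZ, lie_D_D_two]

theorem D_coord_of_length_two {Y : Derivation K R R} (hY : Y ∈ constSpan L) (i j : Fin 2) :
    fr.D j (fr.coord Y i) = fr.coord ⁅fr.D j, Y⁆ i := by
  simp [fr.coord_lie (fr.D j) hY i, lie_D_D_two]

theorem mem_constants_of_length_two {Y : Derivation K R R} (hY : Y ∈ constSpan L) :
    fr.coord Y 1 ∈ constants L :=
  fr.mem_constants fun j => by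
    rw [fr.D_coord_of_length_two hY, fr.coord_D_lie hY (show j ≤ 1 from Fin.le_last j)]

end Two

theorem embeds_two (fr : Frame L 2) (hnil : LieRing.IsNilpotent L) :
    ∃ S : LieSubalgebra (constants L) (triangular (constants L) 2),
      FiniteDimensional (constants L) S ∧ Nonempty (constSpan L ≃ₗ⁅constants L⁆ S) := by
  have : FiniteDimensional (constants L) (constSpan L) := fr.finiteDimensional hnil
  have : CharZero (constants L) := charZero_of_injective_algebraMap
    (algebraMap K (constants L)).injective
  have hs : ∀ Y ∈ constSpan L, fr.coord Y 0 ∈ nilSubalgebra (fr.DF 0) 0 (fr.DF 1) := by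
    refine constSpan_induction hnil (by simp) fun Y hY ih => ?_
    refine mem_nilSubalgebra_of_apply_mem ?_ ?_ ?_
    · rw [DF_apply, fr.D_coord_of_length_two hY, fr.coord_D_lie hY le_rfl]
    · exact Subalgebra.zero_mem _
    · rw [DF_apply, fr.D_coord_of_length_two hY]
      exact ih _ (fr.mem 1)
  have he : ∀ Y ∈ constSpan L, fr.coord Y 1 ∈ nilSubalgebra (fr.DF 0) 0 (fr.DF 1) :=
    fun Y hY => Subalgebra.algebraMap_mem _
      (⟨_, fr.mem_constants_of_length_two hY⟩ : constants L)
  have hact {Y Z : Derivation K R R} (hY : Y ∈ constSpan L) (hZ : Z ∈ constSpan L) (i : Fin 2) :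
      Y (fr.coord Z i) = fr.coord Y 1 * fr.D 1 (fr.coord Z i) := by
    rw [fr.apply_eq_sum hY, Fin.sum_univ_two, fr.D_coord_of_length_two hZ,
      fr.coord_D_lie hZ (Fin.zero_le _), mul_zero, zero_add]
  -- only one nilpotent direction is needed, so the other one is taken to be zero
  obtain ⟨D₁, D₂, τ, hD₁, hD₂, hτ, hS, -, hinj⟩ := exists_taylor_nilSubalgebra
    (Δ₀ := fr.DF 0) (Δ₁ := 0) (Δ₂ := fr.DF 1) (by simp)
    (fun f hf => fr.D_zero_D_eq_zero hf 1) (by simp)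
    (fun f h0 _ h2 => ⟨⟨f, fr.mem_constants fun i => by fin_cases i; exacts [h0, h2]⟩, rfl⟩)
    (0 : MvPolynomial (Fin 2) (constants L)) (X 1)
  have hD₁0 (f) : D₁ f = 0 := Subtype.ext (hD₁ f)
  refine exists_lieSubalgebra_triangular_two (D₂ := D₂) (τ := τ)
    (fun d f => by rw [hτ, map_zero, zero_mul, zero_add])
    (fun S hX => hS S S.zero_mem hX) (hinj fun f _ => by rw [hD₁0, map_zero])
    (fr.coordAlg 0 _ hs) (fr.coordAlg 1 _ he)
    (fun Y => ⟨⟨_, fr.mem_constants_of_length_two Y.2⟩, rfl⟩)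
    (fun Y Z => Subtype.ext ((fr.coord_lie_two Y.2 Z.2 1).trans ?_))
    (fun Y Z => Subtype.ext ((fr.coord_lie_two Y.2 Z.2 0).trans ?_)) (fun Y hs he => ?_)
  · rw [constSpan_apply_const L Y.2 ⟨_, fr.mem_constants_of_length_two Z.2⟩,
      constSpan_apply_const L Z.2 ⟨_, fr.mem_constants_of_length_two Y.2⟩, sub_zero]
    rfl
  · rw [hact Y.2 Z.2, hact Z.2 Y.2]
    push_cast
    rw [hD₂, hD₂]
    rfl
  · refine Subtype.ext (fr.eq_zero Y.2 fun i => ?_)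
    fin_cases i
    exacts [congrArg Subtype.val hs, congrArg Subtype.val he]

omit [CharZero K] in
theorem embeds_one (fr : Frame L 1) (hnil : LieRing.IsNilpotent L) :
    ∃ S : LieSubalgebra (constants L) (triangular (constants L) 1),
      FiniteDimensional (constants L) S ∧ Nonempty (constSpan L ≃ₗ⁅constants L⁆ S) := by
  have : FiniteDimensional (constants L) (constSpan L) := fr.finiteDimensional hnil
  have hD : ⁅fr.D 0, fr.D 0⁆ = 0 := lie_self _
  have hconst {Y : Derivation K R R} (hY : Y ∈ constSpan L) : fr.coord Y 0 ∈ constants L :=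
    fr.mem_constants fun j => by
      obtain rfl : j = 0 := Subsingleton.elim _ _
      have h := fr.coord_lie (fr.D 0) hY 0
      rw [fr.coord_D_lie hY le_rfl] at h
      simpa [hD] using h.symm
  let e : constSpan L →ₗ[constants L] constants L :=
    { toFun := fun Y => ⟨fr.coord Y 0, hconst Y.2⟩
      map_add' := fun Y Z => Subtype.ext (map_add (fr.coordConst 0) (Y : Derivation K R R) Z)
      map_smul' := fun a Y => Subtype.ext (map_smul (fr.coordConst 0) a (Y : Derivation K R R)) }
  have lie_e (Y Z : constSpan L) : e ⁅Y, Z⁆ = 0 := by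
    refine Subtype.ext ?_
    change fr.coord ⁅(Y : Derivation K R R), (Z : Derivation K R R)⁆ 0 = 0
    rw [fr.coord_lie_eq_sum Y.2 Z.2, constSpan_apply_const L Y.2 ⟨_, hconst Z.2⟩,
      constSpan_apply_const L Z.2 ⟨_, hconst Y.2⟩]
    simp
  refine exists_lieSubalgebra_triangular
    (LinearMap.pi fun _ => (Algebra.linearMap _ (MvPolynomial (Fin 1) _)).comp e)
    (fun Y i => Subalgebra.algebraMap_mem _ _) (fun Y Z i => ?_) fun Y hY => ?_
  · simp [lie_e]
  · have h : e Y = 0 := (algebraMap _ (MvPolynomial (Fin 1) (constants L))).injective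
      ((congrFun hY 0).trans (map_zero _).symm)
    refine Subtype.ext (fr.eq_zero Y.2 fun i => ?_)
    obtain rfl : i = 0 := Subsingleton.elim _ _
    exact congrArg Subtype.val h

omit [CharZero K] in
theorem embeds_zero (fr : Frame L 0) (hnil : LieRing.IsNilpotent L) :
    ∃ S : LieSubalgebra (constants L) (triangular (constants L) 0),
      FiniteDimensional (constants L) S ∧ Nonempty (constSpan L ≃ₗ⁅constants L⁆ S) := by
  have : FiniteDimensional (constants L) (constSpan L) := fr.finiteDimensional hnil
  exact exists_lieSubalgebra_triangular 0 (fun _ i => i.elim0) (fun _ _ i => i.elim0)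
    fun Y _ => Subtype.ext (fr.eq_zero Y.2 fun i => i.elim0)

end Frame

end FractionFieldDerivations

theorem theorem2 {K A R : Type*} [Field K] [CharZero K]
    [CommRing A] [IsDomain A] [Algebra K A]
    [Field R] [Algebra A R] [IsFractionRing A R] [Algebra K R] [IsScalarTower K A R]
    (L : LieSubalgebra K (Derivation K R R))
    (hLW : L ≤ FractionFieldDerivations.W K A R)
    (hnil : LieRing.IsNilpotent L)
    (k : ℕ) (hk : k ≤ 3) (hrk : FractionFieldDerivations.rk L = (k : Cardinal)) :
    ∃ S : LieSubalgebra (FractionFieldDerivations.constants L)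
        (FractionFieldDerivations.triangular (FractionFieldDerivations.constants L) k),
      FiniteDimensional (FractionFieldDerivations.constants L) S ∧
      Nonempty (FractionFieldDerivations.constSpan L
        ≃ₗ⁅FractionFieldDerivations.constants L⁆ S) := by
  obtain ⟨fr⟩ := FractionFieldDerivations.exists_frame hnil hrk
  interval_cases k
  · exact fr.embeds_zero hnil
  · exact fr.embeds_one hnil
  · exact fr.embeds_two hnil
  · exact fr.embeds_three hnil
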